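/- Let $\mathbb K$ be an arbitrary field. A nonsymmetric operad is a family of finite-dimensional vector spaces $\mathcal A_n$, $n\ge 0$, with $\mathcal A_0=0$ and $\mathcal A_1=\mathbb K\,\mathrm{id}$, with associative and unital composition maps $\mathcal A_n\otimes\mathcal A_{k_1}\otimes\cdots\otimes\mathcal A_{k_n}\to\mathcal A_{k_1+\cdots+k_n}$. The free $\mathcal A$-algebra on a vector space $V$ is $\mathcal A(V)=\bigoplus_n\mathcal A_n\otimes V^{\otimes n}$. For a nonsymmetric operad $\mathcal C$, a $\mathcal C^c$-coalgebra is a vector space $\mathcal H$ on which each $\delta\in\mathcal C_n$ acts as a linear map $\mathcal H\to\mathcal H^{\otimes n}$, compatibly with composition; put $F_r\mathcal H=\{x : \delta(x)=0 \text{ for all } \delta\in\mathcal C_n,\ n>r\}$ and $\mathrm{Prim}\,\mathcal H=F_1\mathcal H$, and call $\mathcal H$ connected if $\mathcal H=\bigcup_{r\ge1}F_r\mathcal H$. The cofree connected coalgebra on $V$ is $\mathcal C^c(V)=\bigoplus_n\mathcal C_n^*\otimes V^{\otimes n}$, with the coaction dual to the composition of $\mathcal C$. A nonsymmetric type of generalized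 bialgebras consists of nonsymmetric operads $\mathcal C$, $\mathcal A$ and, for every $\delta\in\mathcal C_m$, $\mu\in\mathcal A_n$ with $m,n\ge2$, a compatibility relation $$\delta\circ\mu=\sum(\mu_1\otimes\cdots\otimes\mu_m)\circ(\delta_1\otimes\cdots\otimes\delta_n)\qquad(\text{finite sum},\ \mu_j\in\mathcal A_{k_j},\ \delta_i\in\mathcal C_{l_i},\ \textstyle\sum k_j=\sum l_i)$$ which involves no permutation of the factors. A $\mathcal C^c$-$\mathcal A$-bialgebra is a vector space which is an $\mathcal A$-algebra and a $\mathcal C^c$-coalgebra and satisfies these relations. (H1) Suppose that each free algebra $\mathcal A(V)$ carries a $\mathcal C^c$-$\mathcal A$-bialgebra structure, functorial in $V$. Then the spaces $$\mathcal P_n=\{\mu\in\mathcal A_n : \mu(x_1,\dots,x_n)\in\mathrm{Prim}\,\mathcal A(\mathbb Kx_1\oplus\cdots\oplus\mathbb Kx_n)\}$$ form a suboperad $\mathcal P$ of $\mathcal A$. Let $U$ be the left adjoint of the restriction functor from $\mathcal A$-algebras to $\mathcal P$-algebras, so that $U(L)$ is the quotient of $\mathcal A(L)$ by the ideal generated by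 the elements $\mu\otimes(x_1\otimes\cdots\otimes x_n)-\mu(x_1,\dots,x_n)$, $\mu\in\mathcal P_n$, $x_i\in L$. Let $\varphi(V):\mathcal A(V)\to\mathcal C^c(V)$ be the unique coalgebra map which commutes with the projections to $V$. **Structure theorem.** Suppose moreover (nonsymmetric H2epi) that there are linear maps $s_n:\mathcal C_n^*\to\mathcal A_n$ such that, for every $V$, the induced map $s(V):\mathcal C^c(V)\to\mathcal A(V)$ is a coalgebra map and $\varphi(V)\circ s(V)=\mathrm{Id}$. Then for every $\mathcal C^c$-$\mathcal A$-bialgebra $\mathcal H$ the operations of $\mathcal P$ preserve $\mathrm{Prim}\,\mathcal H$, which so becomes a $\mathcal P$-algebra; $U(\mathrm{Prim}\,\mathcal H)$ has a coalgebra structure for which $\mathcal A(\mathrm{Prim}\,\mathcal H)\to U(\mathrm{Prim}\,\mathcal H)$ is a coalgebra map, and is with it a $\mathcal C^c$-$\mathcal A$-bialgebra; and the following are equivalent: (a) $\mathcal H$ is connected; (b) there is an isomorphism of bialgebras $\mathcal H\cong U(\mathrm{Prim}\,\mathcal H)$; (c) there is an isomorphism of coalgebras $\mathcal H\cong\mathcal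 C^c(\mathrm{Prim}\,\mathcal H)$. **Rigidity theorem.** Suppose instead (H2iso) that (H1) holds and $\varphi(V)$ is an isomorphism for every $V$. Then every connected $\mathcal C^c$-$\mathcal A$-bialgebra $\mathcal H$ is free and cofree over its primitive part: there are an isomorphism of bialgebras $\mathcal A(\mathrm{Prim}\,\mathcal H)\cong\mathcal H$ which is the identity on $\mathrm{Prim}\,\mathcal H$, and an isomorphism of coalgebras $\mathcal H\cong\mathcal C^c(\mathrm{Prim}\,\mathcal H)$ whose composite with the projection to $\mathrm{Prim}\,\mathcal H$ is the identity on $\mathrm{Prim}\,\mathcal H$. -/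

import Mathlib

open scoped TensorProduct DirectSum
universe u
noncomputable section
namespace NSBialg

/-- The order-preserving bijection from the disjoint union of consecutive blocks of sizes
`l 0, l 1, …, l (n-1)` onto `{0, …, N-1}`, where `N` is the sum of the `l j`. -/
def blk {n N : ℕ} {l : Fin n → ℕ} (h : ∑ j, l j = N) : (Σ j : Fin n, Fin (l j)) ≃ Fin N :=
  finSigmaFinEquiv.trans (finCongr h)

theorem blk_val {n N : ℕ} {l : Fin n → ℕ} (h : ∑ j, l j = N) (x : Σ j : Fin n, Fin (l j)) :
    (blk h x : ℕ) = (∑ j : Fin n, if j < x.1 then l j else 0) + x.2 := by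
  simp only [blk, Equiv.trans_apply, finCongr_apply, Fin.val_cast, finSigmaFinEquiv_apply]
  congr 1
  rw [← Finset.sum_filter]
  refine Finset.sum_bij (fun i _ => Fin.castLE x.1.2.le i) ?_ ?_ ?_ ?_
  · intro i _; exact Finset.mem_filter.2 ⟨Finset.mem_univ _, i.2⟩
  · intro i _ j _ hij; exact Fin.castLE_injective _ hij
  · intro b hb
    simp only [Finset.mem_filter, Finset.mem_univ, true_and] at hb
    exact ⟨⟨b, hb⟩, Finset.mem_univ _, rfl⟩
  · intro i _; rfl

theorem blk_lt_iff {n N : ℕ} {l : Fin n → ℕ} (h : ∑ j, l j = N) (j j' : Fin n) (q : Fin (l j))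
    (q' : Fin (l j')) :
    blk h ⟨j', q'⟩ < blk h ⟨j, q⟩ ↔ j' < j ∨ (∃ _ : j' = j, (q' : ℕ) < q) := by
  have key : ∀ (i i' : Fin n) (p : Fin (l i)) (p' : Fin (l i')), i' < i →
      blk h ⟨i', p'⟩ < blk h ⟨i, p⟩ := by
    intro i i' p p' hi
    rw [Fin.lt_def, blk_val, blk_val]
    have h1 : (∑ j : Fin n, if j < i' then l j else 0) + l i' ≤
        ∑ j : Fin n, if j < i then l j else 0 := by
      have : (∑ j : Fin n, if j < i' then l j else 0) + l i' =
          ∑ j : Fin n, ((if j < i' then l j else 0) + if j = i' then l j else 0) := by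
        rw [Finset.sum_add_distrib]; simp
      rw [this]
      refine Finset.sum_le_sum fun j _ => ?_
      rcases lt_trichotomy j i' with hj | hj | hj
      · simp [hj, hj.ne, hj.trans hi]
      · subst hj; simp [hi]
      · simp [hj.not_gt, hj.ne']
    have := p'.2
    simp only
    omega
  rcases lt_trichotomy j' j with hj | hj | hj
  · simp [hj, key j j' q q' hj]
  · subst hj
    rw [Fin.lt_def, blk_val, blk_val]; simp
  · have := key j' j q' q hj
    simp [hj.not_gt, hj.ne', this.le]

theorem blk_assoc {n M N : ℕ} {l : Fin n → ℕ} (h : ∑ j, l j = M) {r : Fin M → ℕ}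
    (hr : ∑ k, r k = N) (h' : ∑ j, ∑ q, r (blk h ⟨j, q⟩) = N)
    (j : Fin n) (q : Fin (l j)) (p : Fin (r (blk h ⟨j, q⟩))) :
    blk hr ⟨blk h ⟨j, q⟩, p⟩ =
      blk (l := fun j => ∑ q, r (blk h ⟨j, q⟩)) h' ⟨j, blk rfl ⟨q, p⟩⟩ := by
  apply Fin.ext
  rw [blk_val, blk_val, blk_val]
  simp only
  rw [← add_assoc]
  congr 1
  rw [← Equiv.sum_comp (blk h), Fintype.sum_sigma]
  have : ∀ x : Fin n, (∑ y : Fin (l x), if blk h ⟨x, y⟩ < blk h ⟨j, q⟩ then r (blk h ⟨x, y⟩) else 0)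
      = (if x < j then ∑ y, r (blk h ⟨x, y⟩) else 0) +
        if x = j then ∑ y : Fin (l j), (if y < q then r (blk h ⟨j, y⟩) else 0) else 0 := by
    intro x
    rcases lt_trichotomy x j with hx | hx | hx
    · simp [blk_lt_iff, hx, hx.ne]
    · subst hx; simp [blk_lt_iff]
    · simp [blk_lt_iff, hx.not_gt, hx.ne']
  simp_rw [this]
  rw [Finset.sum_add_distrib]
  simp

theorem sum_blk {n M N : ℕ} {l : Fin n → ℕ} (h : ∑ j, l j = M) {r : Fin M → ℕ}
    (hr : ∑ k, r k = N) : ∑ j, ∑ q, r (blk h ⟨j, q⟩) = N := by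
  rw [← hr, ← Equiv.sum_comp (blk h), Fintype.sum_sigma]

section tensors
variable {K : Type u} [Field K]

/-- Bracketing of tensors: `v₁ ⊗ ⋯ ⊗ v_N ↦ (first block) ⊗ ⋯ ⊗ (last block)`, the blocks being
consecutive, of sizes `l 0, …, l (n-1)`. -/
def split (V : Type u) [AddCommGroup V] [Module K V] {n N : ℕ} (l : Fin n → ℕ)
    (h : ∑ j, l j = N) : (⨂[K]^N V) →ₗ[K] ⨂[K] j, ⨂[K]^(l j) V :=
  PiTensorProduct.lift
    (((PiTensorProduct.tprod K).compMultilinearMap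
      (fun j => PiTensorProduct.tprod K (s := fun _ : Fin (l j) => V))).domDomCongr (blk h))

theorem split_tprod {V : Type u} [AddCommGroup V] [Module K V] {n N : ℕ} (l : Fin n → ℕ)
    (h : ∑ j, l j = N) (x : Fin N → V) :
    split V l h (PiTensorProduct.tprod K x) =
      PiTensorProduct.tprod K fun j => PiTensorProduct.tprod K fun q => x (blk h ⟨j, q⟩) := by
  simp only [split, PiTensorProduct.lift.tprod]
  rfl

theorem split_bijective (V : Type u) [AddCommGroup V] [Module K V] {n N : ℕ} (l : Fin n → ℕ)
    (h : ∑ j, l j = N) : Function.Bijective (split (K := K) V l h) := by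
  let b := Module.Basis.ofVectorSpace K V
  let B₁ := Basis.piTensorProduct (fun _ : Fin N => b)
  let B₂ := Basis.piTensorProduct
    (fun j : Fin n => Basis.piTensorProduct (fun _ : Fin (l j) => b))
  let e := ((blk h).arrowCongr (Equiv.refl (Module.Basis.ofVectorSpaceIndex K V))).symm.trans
    (Equiv.piCurry (fun _ _ => _))
  have : split (K := K) V l h = (B₁.equiv B₂ e).toLinearMap := by
    refine B₁.ext fun p => ?_
    simp only [LinearEquiv.coe_coe, Module.Basis.equiv_apply]
    simp only [B₁, B₂, Basis.piTensorProduct_apply, split_tprod]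
    rfl
  rw [this]
  exact (B₁.equiv B₂ e).bijective

/-- The isomorphism `V^{⊗N} ≅ V^{⊗ l 0} ⊗ ⋯ ⊗ V^{⊗ l (n-1)}`. -/
def splitEquiv (V : Type u) [AddCommGroup V] [Module K V] {n N : ℕ} (l : Fin n → ℕ)
    (h : ∑ j, l j = N) : (⨂[K]^N V) ≃ₗ[K] ⨂[K] j, ⨂[K]^(l j) V :=
  LinearEquiv.ofBijective (split V l h) (split_bijective V l h)

/-- The map `(⨂ X j) ⊗ (⨂ Y j) → ⨂ (X j ⊗ Y j)`. -/
def zip {n : ℕ} (X Y : Fin n → Type u) [∀ j, AddCommGroup (X j)] [∀ j, Module K (X j)]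
    [∀ j, AddCommGroup (Y j)] [∀ j, Module K (Y j)] :
    (⨂[K] j, X j) ⊗[K] (⨂[K] j, Y j) →ₗ[K] ⨂[K] j, X j ⊗[K] Y j :=
  TensorProduct.lift (PiTensorProduct.map₂ fun j => TensorProduct.mk K (X j) (Y j))

theorem zip_bijective {n : ℕ} (X Y : Fin n → Type u) [∀ j, AddCommGroup (X j)]
    [∀ j, Module K (X j)] [∀ j, AddCommGroup (Y j)] [∀ j, Module K (Y j)] :
    Function.Bijective (zip (K := K) X Y) := by
  let b := fun j => Module.Basis.ofVectorSpace K (X j)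
  let c := fun j => Module.Basis.ofVectorSpace K (Y j)
  let B₁ := (Basis.piTensorProduct b).tensorProduct (Basis.piTensorProduct c)
  let B₂ := Basis.piTensorProduct (fun j => (b j).tensorProduct (c j))
  let e : ((∀ j, Module.Basis.ofVectorSpaceIndex K (X j)) ×
      (∀ j, Module.Basis.ofVectorSpaceIndex K (Y j))) ≃
      ∀ j, Module.Basis.ofVectorSpaceIndex K (X j) × Module.Basis.ofVectorSpaceIndex K (Y j) :=
    { toFun := fun p j => (p.1 j, p.2 j)
      invFun := fun p => (fun j => (p j).1, fun j => (p j).2)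
      left_inv := fun _ => rfl
      right_inv := fun _ => rfl }
  have : zip (K := K) X Y = (B₁.equiv B₂ e).toLinearMap := by
    refine B₁.ext fun p => ?_
    simp only [LinearEquiv.coe_coe, Module.Basis.equiv_apply]
    obtain ⟨p, q⟩ := p
    simp [B₁, B₂, zip, e, Module.Basis.tensorProduct_apply, PiTensorProduct.map₂_tprod_tprod]
  rw [this]
  exact (B₁.equiv B₂ e).bijective

/-- `zip` as an isomorphism. -/
def zipEquiv {n : ℕ} (X Y : Fin n → Type u) [∀ j, AddCommGroup (X j)] [∀ j, Module K (X j)]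
    [∀ j, AddCommGroup (Y j)] [∀ j, Module K (Y j)] :
    (⨂[K] j, X j) ⊗[K] (⨂[K] j, Y j) ≃ₗ[K] ⨂[K] j, X j ⊗[K] Y j :=
  LinearEquiv.ofBijective (zip X Y) (zip_bijective X Y)

theorem splitEquiv_symm_tprod {V : Type u} [AddCommGroup V] [Module K V] {n N : ℕ} (l : Fin n → ℕ)
    (h : ∑ j, l j = N) (x : ∀ j, Fin (l j) → V) :
    (splitEquiv V l h).symm
        (PiTensorProduct.tprod K fun j => PiTensorProduct.tprod K fun q => x j q) =
      PiTensorProduct.tprod K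
        fun k => x ((blk h).symm k).1 ((blk h).symm k).2 := by
  rw [LinearEquiv.symm_apply_eq]
  change _ = split V l h _
  rw [split_tprod]
  congr 1; ext j; congr 1; ext q
  rw [Equiv.symm_apply_apply]

theorem zipEquiv_symm_tprod {n : ℕ} (X Y : Fin n → Type u) [∀ j, AddCommGroup (X j)]
    [∀ j, Module K (X j)] [∀ j, AddCommGroup (Y j)] [∀ j, Module K (Y j)]
    (x : ∀ j, X j) (y : ∀ j, Y j) :
    (zipEquiv X Y).symm (PiTensorProduct.tprod K fun j => x j ⊗ₜ[K] y j) =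
      PiTensorProduct.tprod K x ⊗ₜ[K] PiTensorProduct.tprod K y := by
  rw [LinearEquiv.symm_apply_eq]
  change _ = zip X Y _
  simp [zip, PiTensorProduct.map₂_tprod_tprod]

end tensors

/-- A nonsymmetric operad over the field `K`, with finite-dimensional components, `P(0) = 0` and
`P(1) = K id`. For `l : Fin n → ℕ` with sum `N`, `comp l h μ ν` is the total composite
`μ ∘ (ν 0, …, ν (n-1))`, of arity `N`. -/
structure NSOperad (K : Type u) [Field K] where
  Op : ℕ → Type u
  [instAddCommGroup : ∀ n, AddCommGroup (Op n)]
  [instModule : ∀ n, Module K (Op n)]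
  [instFinite : ∀ n, Module.Finite K (Op n)]
  one : Op 1
  comp : ∀ {n N : ℕ} (l : Fin n → ℕ), ∑ j, l j = N →
    Op n →ₗ[K] MultilinearMap K (fun j => Op (l j)) (Op N)
  one_comp : ∀ {N : ℕ} (h : ∑ _j : Fin 1, N = N) (ν : Op N),
    comp (fun _ : Fin 1 => N) h one (fun _ => ν) = ν
  comp_one : ∀ {n : ℕ} (h : ∑ _j : Fin n, 1 = n) (μ : Op n),
    comp (fun _ : Fin n => 1) h μ (fun _ => one) = μ
  comp_assoc : ∀ {n M N : ℕ} (l : Fin n → ℕ) (h : ∑ j, l j = M) (r : Fin M → ℕ)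
    (hr : ∑ k, r k = N) (h' : ∑ j, ∑ q, r (blk h ⟨j, q⟩) = N)
    (μ : Op n) (ν : ∀ j, Op (l j)) (ξ : ∀ k, Op (r k)),
    comp r hr (comp l h μ ν) ξ =
      comp (fun j => ∑ q, r (blk h ⟨j, q⟩)) h' μ
        (fun j => comp (fun q => r (blk h ⟨j, q⟩)) rfl (ν j) (fun q => ξ (blk h ⟨j, q⟩)))
  subsingleton_zero : Subsingleton (Op 0)
  one_ne_zero : one ≠ 0
  eq_smul_one : ∀ μ : Op 1, ∃ c : K, μ = c • one

attribute [instance] NSOperad.instAddCommGroup NSOperad.instModule NSOperad.instFinite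

variable {K : Type u} [Field K]

/-- An algebra over a nonsymmetric operad: `μ ∈ P(n)` acts as an `n`-linear map `A^n → A`. -/
structure NSOperad.Alg (P : NSOperad K) (A : Type u) [AddCommGroup A] [Module K A] where
  act : ∀ n : ℕ, P.Op n →ₗ[K] MultilinearMap K (fun _ : Fin n => A) A
  act_one : ∀ x : Fin 1 → A, act 1 P.one x = x 0
  act_comp : ∀ {n N : ℕ} (l : Fin n → ℕ) (h : ∑ j, l j = N) (μ : P.Op n) (ν : ∀ j, P.Op (l j))
    (x : Fin N → A),
    act N (P.comp l h μ ν) x = act n μ fun j => act (l j) (ν j) fun q => x (blk h ⟨j, q⟩)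

/-- Morphisms of algebras over an operad. -/
def NSOperad.Alg.IsHom {P : NSOperad K} {A B : Type u} [AddCommGroup A] [Module K A]
    [AddCommGroup B] [Module K B] (a : P.Alg A) (b : P.Alg B) (f : A →ₗ[K] B) : Prop :=
  ∀ (n : ℕ) (μ : P.Op n) (x : Fin n → A), f (a.act n μ x) = b.act n μ fun i => f (x i)

/-- The space underlying the free algebra: `P(V) = ⨁ₙ P(n) ⊗ V^{⊗n}`. -/
abbrev NSOperad.Free (P : NSOperad K) (V : Type u) [AddCommGroup V] [Module K V] : Type u :=
  ⨁ n : ℕ, P.Op n ⊗[K] ⨂[K]^n V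

namespace NSOperad.Free
variable (P : NSOperad K) (V : Type u) [AddCommGroup V] [Module K V]

variable {P V} in
/-- The element `μ ⊗ (v 0 ⊗ ⋯ ⊗ v (n-1))` of `P(V)`. -/
def word {n : ℕ} (μ : P.Op n) (v : Fin n → V) : P.Free V :=
  DirectSum.lof K ℕ (fun n => P.Op n ⊗[K] ⨂[K]^n V) n (μ ⊗ₜ[K] PiTensorProduct.tprod K v)

/-- The action of `P` on `P(V)`, determined by
`μ (ν 0 ⊗ w 0, …, ν (n-1) ⊗ w (n-1)) = (μ ∘ (ν 0, …, ν (n-1))) ⊗ w 0 ⋯ w (n-1)`. -/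
def act (n : ℕ) : P.Op n →ₗ[K] MultilinearMap K (fun _ : Fin n => P.Free V) (P.Free V) where
  toFun μ := MultilinearMap.fromDirectSumEquiv fun p =>
    (DirectSum.lof K ℕ (fun n => P.Op n ⊗[K] ⨂[K]^n V) (∑ j, p j) ∘ₗ
      TensorProduct.map (PiTensorProduct.lift (P.comp p rfl μ))
        (splitEquiv V p rfl).symm.toLinearMap ∘ₗ
      (zipEquiv _ _).symm.toLinearMap).compMultilinearMap (PiTensorProduct.tprod K)
  map_add' μ ν := by
    rw [← map_add]
    congr 1
    ext p x
    simp [TensorProduct.map_add_left]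
  map_smul' c μ := by
    rw [RingHom.id_apply, ← map_smul]
    congr 1
    ext p x
    simp [TensorProduct.map_smul_left]

variable {P V}

theorem word_congr {n N N' : ℕ} (l : Fin n → ℕ) (h : ∑ j, l j = N) (h' : ∑ j, l j = N')
    (μ : P.Op n) (ν : ∀ j, P.Op (l j)) (v : ∀ j, Fin (l j) → V) :
    word (P.comp l h μ ν) (fun k => v ((blk h).symm k).1 ((blk h).symm k).2) =
      word (P.comp l h' μ ν) (fun k => v ((blk h').symm k).1 ((blk h').symm k).2) := by
  subst h; subst h'; rfl

theorem act_word {n N : ℕ} (l : Fin n → ℕ) (h : ∑ j, l j = N) (μ : P.Op n)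
    (ν : ∀ j, P.Op (l j)) (v : ∀ j, Fin (l j) → V) :
    act P V n μ (fun j => word (ν j) (v j)) =
      word (P.comp l h μ ν) (fun k => v ((blk h).symm k).1 ((blk h).symm k).2) := by
  rw [word_congr l h rfl]
  simp only [word, act, LinearMap.coe_mk, AddHom.coe_mk]
  rw [MultilinearMap.fromDirectSumEquiv_lof]
  simp only [LinearMap.compMultilinearMap_apply, LinearMap.comp_apply, LinearEquiv.coe_coe]
  rw [zipEquiv_symm_tprod, TensorProduct.map_tmul, PiTensorProduct.lift.tprod]
  erw [splitEquiv_symm_tprod]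

theorem span_word : Submodule.span K
    (Set.range fun w : (Σ n, P.Op n × (Fin n → V)) => (word w.2.1 w.2.2 : P.Free V)) = ⊤ := by
  rw [eq_top_iff]
  rintro x -
  induction x using DirectSum.induction_on with
  | zero => exact zero_mem _
  | add x y hx hy => exact add_mem hx hy
  | of n t =>
    induction t using TensorProduct.induction_on with
    | zero => rw [map_zero]; exact zero_mem _
    | add x y hx hy => rw [map_add]; exact add_mem hx hy
    | tmul μ t =>
      induction t using PiTensorProduct.induction_on with
      | smul_tprod c v =>
        rw [TensorProduct.tmul_smul, ← DirectSum.lof_eq_of K, map_smul]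
        exact Submodule.smul_mem _ _ (Submodule.subset_span ⟨⟨n, μ, v⟩, rfl⟩)
      | add x y hx hy => rw [TensorProduct.tmul_add, map_add]; exact add_mem hx hy

theorem act_comp {n N : ℕ} (l : Fin n → ℕ) (h : ∑ j, l j = N) (μ : P.Op n)
    (ν : ∀ j, P.Op (l j)) (x : Fin N → P.Free V) :
    act P V N (P.comp l h μ ν) x =
      act P V n μ fun j => act P V (l j) (ν j) fun q => x (blk h ⟨j, q⟩) := by
  have key : act P V N (P.comp l h μ ν) =
      ((act P V n μ).compMultilinearMap fun j => act P V (l j) (ν j)).domDomCongr (blk h) := by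
    refine MultilinearMap.ext_of_span_eq_top
      (g := fun _ (w : Σ n, P.Op n × (Fin n → V)) => word w.2.1 w.2.2) (fun _ => span_word) ?_
    intro w
    have h' := sum_blk h (r := fun k => (w k).1) rfl
    rw [act_word (fun k => (w k).1) rfl _ (fun k => (w k).2.1) (fun k => (w k).2.2)]
    rw [P.comp_assoc l h _ rfl h']
    change _ = act P V n μ fun j => act P V (l j) (ν j)
      fun q => word (w (blk h ⟨j, q⟩)).2.1 (w (blk h ⟨j, q⟩)).2.2
    simp_rw [act_word (fun q => (w (blk h ⟨_, q⟩)).1) rfl _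
      (fun q => (w (blk h ⟨_, q⟩)).2.1) (fun q => (w (blk h ⟨_, q⟩)).2.2)]
    rw [act_word (fun j => ∑ q, (w (blk h ⟨j, q⟩)).1) h']
    congr 1
    ext k
    obtain ⟨⟨k, p⟩, rfl⟩ := (blk (l := fun k => (w k).1) rfl).surjective k
    obtain ⟨⟨j, q⟩, rfl⟩ := (blk h).surjective k
    rw [Equiv.symm_apply_apply, blk_assoc h rfl h', Equiv.symm_apply_apply]
    simp only
    rw [Equiv.symm_apply_apply]
  rw [key]
  rfl


theorem act_one (x : Fin 1 → P.Free V) : act P V 1 P.one x = x 0 := by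
  have key : act P V 1 P.one =
      LinearMap.id.compMultilinearMap (MultilinearMap.ofSubsingleton K _ _ 0 LinearMap.id) := by
    refine MultilinearMap.ext_of_span_eq_top
      (g := fun _ (w : Σ n, P.Op n × (Fin n → V)) => word w.2.1 w.2.2) (fun _ => span_word) ?_
    intro w
    obtain ⟨⟨N, ν, v⟩, rfl⟩ : ∃ w₀, w = fun _ => w₀ :=
      ⟨w 0, funext fun k => by rw [Subsingleton.elim k 0]⟩
    have h : ∑ _j : Fin 1, N = N := by simp
    rw [act_word (fun _ => N) h P.one (fun _ => ν) (fun _ => v), P.one_comp]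
    simp only [LinearMap.compMultilinearMap_apply, LinearMap.id_apply,
      MultilinearMap.ofSubsingleton_apply_apply]
    congr 1
    ext k
    congr 1
    obtain ⟨⟨j, q⟩, rfl⟩ := (blk h).surjective k
    rw [Equiv.symm_apply_apply]
    apply Fin.ext
    rw [blk_val]
    simp
  rw [key]
  rfl

variable (P V)
/-- The free `P`-algebra on `V`. -/
def alg : P.Alg (P.Free V) where
  act := act P V
  act_one := act_one
  act_comp := act_comp

/-- The inclusion of generators `V → P(V)`, `v ↦ id ⊗ v`. -/
def ι : V →ₗ[K] P.Free V :=
  DirectSum.lof K ℕ (fun n => P.Op n ⊗[K] ⨂[K]^n V) 1 ∘ₗ TensorProduct.mk K _ _ P.one ∘ₗ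
    (PiTensorProduct.subsingletonEquiv (R := K) (s := fun _ : Fin 1 => V) 0).symm.toLinearMap

variable {V} in
/-- Functoriality of `V ↦ P(V)`. -/
def map {W : Type u} [AddCommGroup W] [Module K W] (f : V →ₗ[K] W) : P.Free V →ₗ[K] P.Free W :=
  DirectSum.lmap fun _ => TensorProduct.map LinearMap.id (PiTensorProduct.map fun _ => f)

/-- `K ≅ P(1)`, `c ↦ c id`. -/
def unitEquiv : K ≃ₗ[K] P.Op 1 :=
  LinearEquiv.ofBijective (LinearMap.toSpanSingleton K (P.Op 1) P.one)
    ⟨fun c d h => smul_left_injective K P.one_ne_zero (by simpa using h),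
      fun μ => (P.eq_smul_one μ).imp fun _ h => h.symm⟩

/-- The projection of `P(V)` onto its component `P(1) ⊗ V = V`. -/
def proj : P.Free V →ₗ[K] V :=
  (TensorProduct.lid K V).toLinearMap ∘ₗ
    TensorProduct.map (unitEquiv P).symm.toLinearMap
      (PiTensorProduct.subsingletonEquiv (R := K) (s := fun _ : Fin 1 => V) 0).toLinearMap ∘ₗ
    DirectSum.component K ℕ (fun n => P.Op n ⊗[K] ⨂[K]^n V) 1

variable {P V}

theorem ι_apply (v : V) : ι P V v = word P.one fun _ => v := by
  simp only [ι, word, LinearMap.comp_apply, LinearEquiv.coe_coe, TensorProduct.mk_apply]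
  congr 2
  rw [LinearEquiv.symm_apply_eq, PiTensorProduct.subsingletonEquiv_apply_tprod]

theorem proj_ι (v : V) : proj P V (ι P V v) = v := by
  have : (unitEquiv P).symm P.one = 1 := by
    rw [LinearEquiv.symm_apply_eq]
    exact (one_smul K P.one).symm
  simp [ι, proj, this]

theorem word_eq (n : ℕ) (μ : P.Op n) (v : Fin n → V) :
    word μ v = act P V n μ fun i => ι P V (v i) := by
  simp_rw [ι_apply]
  have h : ∑ _j : Fin n, 1 = n := by simp
  rw [act_word (fun _ => 1) h μ (fun _ => P.one) (fun j _ => v j), P.comp_one]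
  congr 1
  ext k
  congr 1
  obtain ⟨⟨j, q⟩, rfl⟩ := (blk h).surjective k
  rw [Equiv.symm_apply_apply]
  apply Fin.ext
  rw [blk_val]
  have : (∑ i : Fin n, if i < j then 1 else 0) = (j : ℕ) := by
    rw [Finset.sum_boole, Nat.cast_id]
    rw [Finset.filter_gt_eq_Iio, Fin.card_Iio]
  simp [this]

/-- The extension of a linear map `f : V → A` to the free algebra. -/
def lift {A : Type u} [AddCommGroup A] [Module K A] (a : P.Alg A) (f : V →ₗ[K] A) :
    P.Free V →ₗ[K] A :=
  DirectSum.toModule K ℕ _ fun n => TensorProduct.lift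
    (((PiTensorProduct.lift (R := K)).toLinearMap ∘ₗ
      MultilinearMap.compLinearMapₗ (fun _ => f)) ∘ₗ a.act n)

theorem lift_word {A : Type u} [AddCommGroup A] [Module K A] (a : P.Alg A) (f : V →ₗ[K] A)
    {n : ℕ} (μ : P.Op n) (v : Fin n → V) :
    lift a f (word μ v) = a.act n μ fun i => f (v i) := by
  simp [lift, word]

end NSOperad.Free


/-- A coalgebra over a nonsymmetric operad `C` (that is, a `C^c`-coalgebra): `δ ∈ C(n)` acts as a
linear map `H → H^{⊗n}`, and `δ ∘ (ε 0, …, ε (n-1))` acts as `(ε 0 ⊗ ⋯ ⊗ ε (n-1)) ∘ δ`. -/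
structure NSOperad.Coalg (C : NSOperad K) (H : Type u) [AddCommGroup H] [Module K H] where
  coact : ∀ n : ℕ, C.Op n →ₗ[K] H →ₗ[K] ⨂[K]^n H
  coact_one : ∀ x : H, coact 1 C.one x = PiTensorProduct.tprod K fun _ => x
  coact_comp : ∀ {n N : ℕ} (l : Fin n → ℕ) (h : ∑ j, l j = N) (δ : C.Op n)
    (ε : ∀ j, C.Op (l j)) (x : H),
    coact N (C.comp l h δ ε) x =
      (splitEquiv H l h).symm (PiTensorProduct.map (fun j => coact (l j) (ε j)) (coact n δ x))

/-- The space underlying the cofree connected coalgebra: `C^c(V) = ⨁ₙ C(n)^* ⊗ V^{⊗n}`. -/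
abbrev NSOperad.Cofree (C : NSOperad K) (V : Type u) [AddCommGroup V] [Module K V] : Type u :=
  ⨁ n : ℕ, Module.Dual K (C.Op n) ⊗[K] ⨂[K]^n V

instance NSOperad.instAddCommGroupCofree (C : NSOperad K) (V : Type u) [AddCommGroup V]
    [Module K V] : AddCommGroup (C.Cofree V) :=
  Module.addCommMonoidToAddCommGroup K

namespace NSOperad.Cofree
variable (C : NSOperad K) (V : Type u) [AddCommGroup V] [Module K V]

/-- The component of the coaction of `δ ∈ C(m)` on `C(N)^* ⊗ V^{⊗N}` with values in the tensor
product of the `C(l j)^* ⊗ V^{⊗ l j}`: the functional `f` goes to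
`ε 0 ⊗ ⋯ ⊗ ε (m-1) ↦ f (δ ∘ (ε 0, …, ε (m-1)))`, and the tensor is cut into blocks. -/
def coactAux {m N : ℕ} (l : Fin m → ℕ) (h : ∑ j, l j = N) :
    C.Op m →ₗ[K] Module.Dual K (C.Op N) ⊗[K] (⨂[K]^N V) →ₗ[K] ⨂[K]^m (C.Cofree V) where
  toFun δ :=
    PiTensorProduct.map
        (fun j => DirectSum.lof K ℕ (fun n => Module.Dual K (C.Op n) ⊗[K] ⨂[K]^n V) (l j)) ∘ₗ
      zip (fun j => Module.Dual K (C.Op (l j))) (fun j => ⨂[K]^(l j) V) ∘ₗ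
      TensorProduct.map
        (PiTensorProduct.dualDistribEquiv.symm.toLinearMap ∘ₗ
          Module.Dual.transpose (R := K) (PiTensorProduct.lift (C.comp l h δ)))
        (split V l h)
  map_add' δ δ' := by
    rw [map_add, map_add, map_add, LinearMap.comp_add, TensorProduct.map_add_left,
      LinearMap.comp_add, LinearMap.comp_add]
  map_smul' c δ := by
    rw [map_smul, map_smul, map_smul, LinearMap.comp_smul, TensorProduct.map_smul_left,
      LinearMap.comp_smul, LinearMap.comp_smul, RingHom.id_apply]

/-- The coaction of `C` on `C^c(V)`, dual to the composition of `C`. -/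
def coact (m : ℕ) : C.Op m →ₗ[K] C.Cofree V →ₗ[K] ⨂[K]^m (C.Cofree V) where
  toFun δ := DirectSum.toModule K ℕ _ fun N =>
    ∑ l ∈ (Finset.Nat.antidiagonalTuple m N).attach,
      coactAux C V l.1 (Finset.Nat.mem_antidiagonalTuple.1 l.2) δ
  map_add' δ δ' := by
    ext N : 1
    simp [LinearMap.add_comp, Finset.sum_add_distrib, LinearMap.ext_iff]
  map_smul' c δ := by
    ext N : 1
    simp [Finset.smul_sum, LinearMap.ext_iff]

/-- The projection of `C^c(V)` onto its component `C(1)^* ⊗ V = V`. -/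
def proj : C.Cofree V →ₗ[K] V :=
  (TensorProduct.lid K V).toLinearMap ∘ₗ
    TensorProduct.map (Module.Dual.eval K (C.Op 1) C.one)
      (PiTensorProduct.subsingletonEquiv (R := K) (s := fun _ : Fin 1 => V) 0).toLinearMap ∘ₗ
    DirectSum.component K ℕ (fun n => Module.Dual K (C.Op n) ⊗[K] ⨂[K]^n V) 1

/-- Pairing with `ε ∈ C(n)`: the map `C^c(V) → V^{⊗n}`, `f ⊗ t ↦ f(ε) t`, zero on the components
of degree other than `n`. -/
def ev {n : ℕ} (ε : C.Op n) : C.Cofree V →ₗ[K] ⨂[K]^n V :=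
  (TensorProduct.lid K (⨂[K]^n V)).toLinearMap ∘ₗ
    (Module.Dual.eval K (C.Op n) ε).rTensor (⨂[K]^n V) ∘ₗ
    DirectSum.component K ℕ (fun n => Module.Dual K (C.Op n) ⊗[K] ⨂[K]^n V) n

variable {C V}

theorem ev_lof {n : ℕ} (ε : C.Op n) (f : Module.Dual K (C.Op n)) (t : ⨂[K]^n V) :
    ev C V ε (DirectSum.lof K ℕ (fun n => Module.Dual K (C.Op n) ⊗[K] ⨂[K]^n V) n (f ⊗ₜ[K] t)) =
      f ε • t := by
  simp [ev]

theorem ev_lof_ne {n m : ℕ} (hnm : m ≠ n) (ε : C.Op n) (t : Module.Dual K (C.Op m) ⊗[K] ⨂[K]^m V) :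
    ev C V ε (DirectSum.lof K ℕ (fun n => Module.Dual K (C.Op n) ⊗[K] ⨂[K]^n V) m t) = 0 := by
  have : DirectSum.component K ℕ (fun n => Module.Dual K (C.Op n) ⊗[K] ⨂[K]^n V) n
      (DirectSum.lof K ℕ (fun n => Module.Dual K (C.Op n) ⊗[K] ⨂[K]^n V) m t) = 0 :=
    DirectSum.of_eq_of_ne _ _ _ hnm.symm
  simp only [ev, LinearMap.comp_apply, this, map_zero]

theorem map_ev_zip {m : ℕ} (l : Fin m → ℕ) (ε : ∀ j, C.Op (l j))
    (F : ⨂[K] j, Module.Dual K (C.Op (l j))) (w : ⨂[K] j, ⨂[K]^(l j) V) :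
    PiTensorProduct.map (fun j => ev C V (ε j)) (PiTensorProduct.map
        (fun j => DirectSum.lof K ℕ (fun n => Module.Dual K (C.Op n) ⊗[K] ⨂[K]^n V) (l j))
          (zip (fun j => Module.Dual K (C.Op (l j))) (fun j => ⨂[K]^(l j) V) (F ⊗ₜ[K] w))) =
      PiTensorProduct.dualDistrib F (PiTensorProduct.tprod K ε) • w := by
  induction F using PiTensorProduct.induction_on with
  | add x y hx hy =>
    rw [TensorProduct.add_tmul, map_add, map_add, map_add, hx, hy, map_add, LinearMap.add_apply,
      add_smul]
  | smul_tprod c f =>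
    induction w using PiTensorProduct.induction_on with
    | add x y hx hy => rw [TensorProduct.tmul_add, map_add, map_add, map_add, hx, hy, smul_add]
    | smul_tprod d w =>
      rw [← TensorProduct.smul_tmul', TensorProduct.tmul_smul]
      simp only [map_smul, zip, TensorProduct.lift.tmul, PiTensorProduct.map₂_tprod_tprod,
        PiTensorProduct.map_tprod, TensorProduct.mk_apply, LinearMap.smul_apply,
        PiTensorProduct.dualDistrib_apply, ev_lof]
      rw [MultilinearMap.map_smul_univ, smul_comm d, smul_assoc]

theorem map_eq_zero {ι : Type} [Fintype ι] {X Y : ι → Type u} [∀ i, AddCommMonoid (X i)]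
    [∀ i, Module K (X i)] [∀ i, AddCommMonoid (Y i)] [∀ i, Module K (Y i)]
    (f : ∀ i, X i →ₗ[K] Y i) (i : ι) (hi : f i = 0) : PiTensorProduct.map f = 0 := by
  ext x
  simp only [LinearMap.compMultilinearMap_apply, PiTensorProduct.map_tprod, LinearMap.zero_apply]
  exact MultilinearMap.map_coord_zero _ i (by rw [hi]; rfl)

theorem map_ev_coact {m N : ℕ} (l : Fin m → ℕ) (h : ∑ j, l j = N) (δ : C.Op m)
    (ε : ∀ j, C.Op (l j)) (y : C.Cofree V) :
    PiTensorProduct.map (fun j => ev C V (ε j)) (coact C V m δ y) =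
      split V l h (ev C V (C.comp l h δ ε) y) := by
  induction y using DirectSum.induction_on with
  | zero => simp
  | add x y hx hy => rw [map_add, map_add, hx, hy, map_add, map_add]
  | of N' t =>
    rw [← DirectSum.lof_eq_of K]
    have hl : ∀ l' ∈ (Finset.Nat.antidiagonalTuple m N').attach, l'.1 ≠ l →
        PiTensorProduct.map (fun j => ev C V (ε j))
          (coactAux C V l'.1 (Finset.Nat.mem_antidiagonalTuple.1 l'.2) δ t) = 0 := by
      intro l' _ hl'
      obtain ⟨j, hj⟩ := Function.ne_iff.1 hl'
      simp only [coactAux, LinearMap.coe_mk, AddHom.coe_mk, LinearMap.comp_apply]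
      rw [← LinearMap.comp_apply, ← PiTensorProduct.map_comp]
      exact LinearMap.congr_fun
        (map_eq_zero _ j (LinearMap.ext fun x => ev_lof_ne hj (ε j) x)) _
    simp only [coact, LinearMap.coe_mk, AddHom.coe_mk, DirectSum.toModule_lof,
      LinearMap.sum_apply, map_sum]
    by_cases hN : N' = N
    · subst hN
      rw [Finset.sum_eq_single ⟨l, Finset.Nat.mem_antidiagonalTuple.2 h⟩]
      · clear hl
        induction t using TensorProduct.induction_on with
        | zero => simp
        | add x y hx hy => simp only [map_add, hx, hy]
        | tmul f v =>
          rw [ev_lof, map_smul]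
          simp only [coactAux, LinearMap.coe_mk, AddHom.coe_mk, LinearMap.comp_apply,
            TensorProduct.map_tmul]
          rw [map_ev_zip]
          congr 1
          have := LinearEquiv.apply_symm_apply (PiTensorProduct.dualDistribEquiv (R := K)
            (M := fun j => C.Op (l j)))
            (Module.Dual.transpose (R := K) (PiTensorProduct.lift (C.comp l h δ)) f)
          have := LinearMap.congr_fun this (PiTensorProduct.tprod K ε)
          refine Eq.trans this ?_
          simp [Module.Dual.transpose_apply]
      · intro l' h1 h2
        exact hl l' h1 fun h3 => h2 (Subtype.ext h3)
      · intro h; exact absurd (Finset.mem_attach _ _) h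
    · rw [ev_lof_ne hN, map_zero]
      refine Finset.sum_eq_zero fun l' h1 => hl l' h1 ?_
      rintro h3
      exact hN ((Finset.Nat.mem_antidiagonalTuple.1 l'.2).symm.trans (h3 ▸ h))


theorem ext_ev {m : ℕ} {z z' : ⨂[K]^m (C.Cofree V)}
    (h : ∀ (l : Fin m → ℕ) (ε : ∀ j, C.Op (l j)),
      PiTensorProduct.map (fun j => ev C V (ε j)) z =
        PiTensorProduct.map (fun j => ev C V (ε j)) z') : z = z' := by
  classical
  let b := fun n => Module.finBasis K (C.Op n)
  let c := Module.Basis.ofVectorSpace K V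
  let cc := fun n : ℕ => Basis.piTensorProduct (fun _ : Fin n => c)
  let B := DFinsupp.basis fun n => (b n).dualBasis.tensorProduct (cc n)
  have hBr : ∀ (x : C.Cofree V) n i w, B.repr x ⟨n, i, w⟩ =
      ((b n).dualBasis.tensorProduct (cc n)).repr (x n) (i, w) := fun _ _ _ _ => rfl
  have hB : ∀ (x : C.Cofree V) (p : Σ n, Fin (Module.finrank K (C.Op n)) × (Fin n → _)),
      B.repr x p = (cc p.1).repr (ev C V (b p.1 p.2.1) x) p.2.2 := by
    rintro x ⟨n, i, w⟩
    induction x using DirectSum.induction_on with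
    | zero => simp
    | add x y hx hy => rw [map_add, Finsupp.add_apply, hx, hy, map_add, map_add, Finsupp.add_apply]
    | of N t =>
      rw [← DirectSum.lof_eq_of K]
      by_cases hN : N = n
      · subst hN
        induction t using TensorProduct.induction_on with
        | zero => simp
        | add x y hx hy =>
          rw [map_add, map_add, Finsupp.add_apply, hx, hy, map_add, map_add, Finsupp.add_apply]
        | tmul f v =>
          rw [ev_lof, map_smul, Finsupp.smul_apply]
          rw [hBr, DirectSum.lof_apply]
          simp [mul_comm]
      · rw [ev_lof_ne hN, hBr, DirectSum.lof_eq_of, DirectSum.of_eq_of_ne _ _ _ (Ne.symm hN)]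
        simp
  refine (Basis.piTensorProduct fun _ : Fin m => B).ext_elem fun p => ?_
  have key : ∀ z, (Basis.piTensorProduct fun _ : Fin m => B).repr z p =
      (Basis.piTensorProduct fun j => cc (p j).1).repr
        (PiTensorProduct.map (fun j => ev C V (b (p j).1 (p j).2.1)) z) (fun j => (p j).2.2) := by
    intro z
    induction z using PiTensorProduct.induction_on with
    | add x y hx hy => simp only [map_add, Finsupp.add_apply, hx, hy]
    | smul_tprod r x => simp [hB]
  rw [key, key, h]


theorem split_one {N : ℕ} (h : ∑ _j : Fin 1, N = N) (t : ⨂[K]^N V) :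
    split V (fun _ : Fin 1 => N) h t = PiTensorProduct.tprod K fun _ => t := by
  have : ∀ q, blk h ⟨0, q⟩ = q := fun q => Fin.ext (by rw [blk_val]; simp)
  have key : split V (fun _ : Fin 1 => N) h =
      (PiTensorProduct.subsingletonEquiv (R := K) (s := fun _ : Fin 1 => ⨂[K]^N V)
        0).symm.toLinearMap := by
    refine PiTensorProduct.ext (MultilinearMap.ext fun x => ?_)
    change split V _ h (PiTensorProduct.tprod K x) =
      (PiTensorProduct.subsingletonEquiv (R := K) (s := fun _ : Fin 1 => ⨂[K]^N V) 0).symm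
        (PiTensorProduct.tprod K x)
    rw [split_tprod, LinearEquiv.eq_symm_apply, PiTensorProduct.subsingletonEquiv_apply_tprod]
    simp_rw [this]
  rw [key, LinearEquiv.coe_coe, LinearEquiv.symm_apply_eq,
    PiTensorProduct.subsingletonEquiv_apply_tprod]

theorem coact_one (y : C.Cofree V) :
    coact C V 1 C.one y = PiTensorProduct.tprod K fun _ => y := by
  refine ext_ev fun l ε => ?_
  obtain ⟨N, rfl⟩ : ∃ N, l = fun _ => N := ⟨l 0, funext fun k => by rw [Subsingleton.elim k 0]⟩
  obtain ⟨ε, rfl⟩ : ∃ ε', ε = fun _ => ε' := ⟨ε 0, funext fun k => by rw [Subsingleton.elim k 0]⟩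
  have h : ∑ _j : Fin 1, N = N := by simp
  rw [map_ev_coact _ h, C.one_comp, PiTensorProduct.map_tprod, split_one]

/-- `ev`, with values in the tensor module. -/
def evT {n : ℕ} (ε : C.Op n) : C.Cofree V →ₗ[K] ⨁ n, ⨂[K]^n V :=
  DirectSum.lof K ℕ (fun n => ⨂[K]^n V) n ∘ₗ ev C V ε

theorem map_evT_coact {m N : ℕ} (l : Fin m → ℕ) (h : ∑ j, l j = N) (δ : C.Op m)
    (ε : ∀ j, C.Op (l j)) (y : C.Cofree V) :
    PiTensorProduct.map (fun j => evT (ε j)) (coact C V m δ y) =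
      PiTensorProduct.map (fun j => DirectSum.lof K ℕ (fun n => ⨂[K]^n V) (l j))
        (split V l h (ev C V (C.comp l h δ ε) y)) := by
  rw [← map_ev_coact l h]
  simp only [evT]
  rw [PiTensorProduct.map_comp, LinearMap.comp_apply]

theorem ext_evT {m : ℕ} {z z' : ⨂[K]^m (C.Cofree V)}
    (h : ∀ (l : Fin m → ℕ) (ε : ∀ j, C.Op (l j)),
      PiTensorProduct.map (fun j => evT (V := V) (ε j)) z =
        PiTensorProduct.map (fun j => evT (V := V) (ε j)) z') : z = z' := by
  refine ext_ev fun l ε => ?_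
  have key : (fun j => ev C V (ε j)) =
      fun j => DirectSum.component K ℕ (fun n => ⨂[K]^n V) (l j) ∘ₗ evT (ε j) := by
    funext j
    refine LinearMap.ext fun x => ?_
    exact (DirectSum.lof_apply K (M := fun n => ⨂[K]^n V) (l j) (ev C V (ε j) x)).symm
  rw [key, PiTensorProduct.map_comp, LinearMap.comp_apply, LinearMap.comp_apply, h]

theorem split_map {U W : Type u} [AddCommGroup U] [Module K U] [AddCommGroup W] [Module K W]
    {n N : ℕ} (l : Fin n → ℕ) (h : ∑ j, l j = N) (f : Fin N → U →ₗ[K] W) (t : ⨂[K]^N U) :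
    split W l h (PiTensorProduct.map f t) =
      PiTensorProduct.map (fun j => PiTensorProduct.map fun q => f (blk h ⟨j, q⟩))
        (split U l h t) := by
  have : split W l h ∘ₗ PiTensorProduct.map f =
      PiTensorProduct.map (fun j => PiTensorProduct.map fun q => f (blk h ⟨j, q⟩)) ∘ₗ
        split U l h := by
    ext x
    simp [split_tprod]
  exact LinearMap.congr_fun this t

theorem coact_comp {n N : ℕ} (l : Fin n → ℕ) (h : ∑ j, l j = N) (δ : C.Op n)
    (ε : ∀ j, C.Op (l j)) (y : C.Cofree V) :
    coact C V N (C.comp l h δ ε) y = (splitEquiv (C.Cofree V) l h).symm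
      (PiTensorProduct.map (fun j => coact C V (l j) (ε j)) (coact C V n δ y)) := by
  refine ext_evT fun r η => ?_
  apply (splitEquiv (⨁ n, ⨂[K]^n V) l h).injective
  change split _ l h _ = split _ l h _
  have h' := sum_blk h (r := r) rfl
  rw [map_evT_coact r rfl, split_map]
  change _ = PiTensorProduct.map _ (splitEquiv _ l h _)
  rw [LinearEquiv.apply_symm_apply, ← LinearMap.comp_apply (PiTensorProduct.map _)
    (PiTensorProduct.map _), ← PiTensorProduct.map_comp]
  have key : (fun j => (PiTensorProduct.map fun q => evT (V := V) (η (blk h ⟨j, q⟩))) ∘ₗ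
        coact C V (l j) (ε j)) =
      fun j => ((PiTensorProduct.map fun q =>
        DirectSum.lof K ℕ (fun n => ⨂[K]^n V) (r (blk h ⟨j, q⟩))) ∘ₗ split V _ rfl) ∘ₗ
          ev C V (C.comp (fun q => r (blk h ⟨j, q⟩)) rfl (ε j) fun q => η (blk h ⟨j, q⟩)) := by
    funext j
    refine LinearMap.ext fun x => ?_
    exact map_evT_coact _ rfl _ _ _
  rw [key, PiTensorProduct.map_comp, LinearMap.comp_apply,
    map_ev_coact (fun j => ∑ q, r (blk h ⟨j, q⟩)) h', ← C.comp_assoc l h r rfl h']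
  generalize ev C V _ y = t
  have : split _ l h ∘ₗ (PiTensorProduct.map fun k =>
        DirectSum.lof K ℕ (fun n => ⨂[K]^n V) (r k)) ∘ₗ split V r rfl =
      (PiTensorProduct.map fun j => (PiTensorProduct.map fun q =>
        DirectSum.lof K ℕ (fun n => ⨂[K]^n V) (r (blk h ⟨j, q⟩))) ∘ₗ split V _ rfl) ∘ₗ
      split V (fun j => ∑ q, r (blk h ⟨j, q⟩)) h' := by
    ext x
    simp only [LinearMap.compMultilinearMap_apply, LinearMap.comp_apply, split_tprod,
      PiTensorProduct.map_tprod]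
    congr 1
    ext j : 1
    congr 1
    ext q : 1
    congr 2
    ext p : 1
    rw [blk_assoc h rfl h']
  have := LinearMap.congr_fun this t
  simpa only [LinearMap.comp_apply] using this

variable (C V) in
/-- The cofree connected `C`-coalgebra on `V`. -/
def coalg : C.Coalg (C.Cofree V) where
  coact := coact C V
  coact_one := coact_one
  coact_comp := coact_comp

end NSOperad.Cofree


theorem NSOperad.Free.lift_isHom {P : NSOperad K} {V A : Type u} [AddCommGroup V] [Module K V]
    [AddCommGroup A] [Module K A] (a : P.Alg A) (f : V →ₗ[K] A) :
    (NSOperad.Free.alg P V).IsHom a (NSOperad.Free.lift a f) := by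
  intro n μ x
  have key : (NSOperad.Free.lift a f).compMultilinearMap (NSOperad.Free.act P V n μ) =
      (a.act n μ).compLinearMap fun _ => NSOperad.Free.lift a f := by
    refine MultilinearMap.ext_of_span_eq_top
      (g := fun _ (w : Σ n, P.Op n × (Fin n → V)) => NSOperad.Free.word w.2.1 w.2.2)
      (fun _ => NSOperad.Free.span_word) ?_
    intro w
    change NSOperad.Free.lift a f (NSOperad.Free.act P V n μ fun k =>
        NSOperad.Free.word (w k).2.1 (w k).2.2) =
      a.act n μ fun k => NSOperad.Free.lift a f (NSOperad.Free.word (w k).2.1 (w k).2.2)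
    rw [NSOperad.Free.act_word (fun k => (w k).1) rfl _ (fun k => (w k).2.1) (fun k => (w k).2.2)]
    rw [NSOperad.Free.lift_word, a.act_comp]
    congr 1
    ext k
    rw [NSOperad.Free.lift_word]
    congr 1
    ext q
    exact congrArg (fun z : Σ j : Fin n, Fin (w j).1 => f ((w z.1).2.2 z.2))
      (Equiv.symm_apply_apply (blk rfl) ⟨k, q⟩)
  exact congrArg (fun g => g x) key

theorem NSOperad.Free.existsUnique_lift {P : NSOperad K} {V A : Type u} [AddCommGroup V]
    [Module K V] [AddCommGroup A] [Module K A] (a : P.Alg A) (f : V →ₗ[K] A) :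
    ∃! g : P.Free V →ₗ[K] A, (NSOperad.Free.alg P V).IsHom a g ∧
      ∀ v, g (NSOperad.Free.ι P V v) = f v := by
  have h : ∀ v, NSOperad.Free.lift a f (NSOperad.Free.ι P V v) = f v := fun v => by
    rw [NSOperad.Free.ι_apply, NSOperad.Free.lift_word, a.act_one]
  refine ⟨NSOperad.Free.lift a f, ⟨NSOperad.Free.lift_isHom a f, h⟩, ?_⟩
  rintro g ⟨hg, hgι⟩
  refine LinearMap.ext_on_range NSOperad.Free.span_word ?_
  rintro ⟨n, μ, v⟩
  simp only
  rw [NSOperad.Free.word_eq]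
  refine (hg n μ _).trans (Eq.trans ?_ (NSOperad.Free.lift_isHom a f n μ _).symm)
  simp_rw [h, hgι]

namespace NSOperad.Alg
variable {P : NSOperad K} {A : Type u} [AddCommGroup A] [Module K A]

/-- Operadic ideals of an algebra. -/
def IsIdeal (a : P.Alg A) (I : Submodule K A) : Prop :=
  ∀ (n : ℕ) (μ : P.Op n) (x : Fin n → A) (i : Fin n), x i ∈ I → a.act n μ x ∈ I

/-- The ideal generated by a set. -/
def idealSpan (a : P.Alg A) (S : Set A) : Submodule K A :=
  sInf {I | a.IsIdeal I ∧ S ⊆ I}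

theorem isIdeal_idealSpan (a : P.Alg A) (S : Set A) : a.IsIdeal (a.idealSpan S) := by
  intro n μ x i hx
  simp only [idealSpan, Submodule.mem_sInf] at hx ⊢
  exact fun I hI => hI.1 n μ x i (hx I hI)

theorem mkQ_act_congr (a : P.Alg A) {I : Submodule K A} (hI : a.IsIdeal I) {n : ℕ} (μ : P.Op n)
    {x y : Fin n → A} (h : ∀ i, I.mkQ (x i) = I.mkQ (y i)) :
    I.mkQ (a.act n μ x) = I.mkQ (a.act n μ y) := by
  classical
  have key : ∀ s : Finset (Fin n),
      I.mkQ (a.act n μ (s.piecewise y x)) = I.mkQ (a.act n μ x) := by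
    intro s
    induction s using Finset.induction_on with
    | empty => simp
    | insert i s hi ih =>
      rw [← ih, ← sub_eq_zero, ← map_sub, Finset.piecewise_insert]
      have h1 : s.piecewise y x = Function.update (s.piecewise y x) i (x i) := by
        rw [eq_comm, Function.update_eq_self_iff, Finset.piecewise_eq_of_notMem _ _ _ hi]
      rw [show a.act n μ (s.piecewise y x) =
        a.act n μ (Function.update (s.piecewise y x) i (x i)) from congrArg _ h1,
        ← MultilinearMap.map_update_sub, Submodule.mkQ_apply, Submodule.Quotient.mk_eq_zero]
      refine hI n μ _ i ?_
      rw [Function.update_self, ← Submodule.Quotient.mk_eq_zero, ← Submodule.mkQ_apply, map_sub,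
        h i, sub_self]
  simpa using (key Finset.univ).symm

/-- The action on the quotient by an ideal. -/
def quotAct (a : P.Alg A) (I : Submodule K A) (hI : a.IsIdeal I) (n : ℕ) :
    P.Op n →ₗ[K] MultilinearMap K (fun _ : Fin n => A ⧸ I) (A ⧸ I) where
  toFun μ :=
    { toFun := fun x => I.mkQ (a.act n μ fun i => (x i).out)
      map_update_add' := by
        intro _ m i x y
        obtain ⟨x, rfl⟩ := I.mkQ_surjective x
        obtain ⟨y, rfl⟩ := I.mkQ_surjective y
        rw [← map_add I.mkQ x y]
        have h : ∀ z : A, I.mkQ (a.act n μ fun j => (Function.update m i (I.mkQ z) j).out) =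
            I.mkQ (a.act n μ (Function.update (fun j => (m j).out) i z)) := by
          intro z
          refine a.mkQ_act_congr hI μ fun j => ?_
          by_cases hj : j = i
          · subst hj; simp
          · simp [hj]
        refine (h (x + y)).trans ?_
        rw [MultilinearMap.map_update_add, map_add]
        exact congrArg₂ (· + ·) (h x).symm (h y).symm
      map_update_smul' := by
        intro _ m i c x
        obtain ⟨x, rfl⟩ := I.mkQ_surjective x
        rw [← map_smul I.mkQ c x]
        have h : ∀ z : A, I.mkQ (a.act n μ fun j => (Function.update m i (I.mkQ z) j).out) =
            I.mkQ (a.act n μ (Function.update (fun j => (m j).out) i z)) := by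
          intro z
          refine a.mkQ_act_congr hI μ fun j => ?_
          by_cases hj : j = i
          · subst hj; simp
          · simp [hj]
        refine (h (c • x)).trans ?_
        rw [MultilinearMap.map_update_smul, map_smul]
        exact congrArg (c • ·) (h x).symm }
  map_add' μ ν := by ext x; simp
  map_smul' c μ := by ext x; simp

theorem quotAct_mkQ (a : P.Alg A) (I : Submodule K A) (hI : a.IsIdeal I) {n : ℕ} (μ : P.Op n)
    (x : Fin n → A) :
    a.quotAct I hI n μ (fun i => I.mkQ (x i)) = I.mkQ (a.act n μ x) :=
  a.mkQ_act_congr hI μ fun i => by simp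

/-- The quotient of an algebra by an ideal. -/
def quot (a : P.Alg A) (I : Submodule K A) (hI : a.IsIdeal I) : P.Alg (A ⧸ I) where
  act := a.quotAct I hI
  act_one x := by
    obtain ⟨x, rfl⟩ : ∃ y : Fin 1 → A, x = fun i => I.mkQ (y i) :=
      ⟨fun i => (x i).out, by simp⟩
    rw [quotAct_mkQ, a.act_one]
  act_comp {n N} l h μ ν x := by
    obtain ⟨x, rfl⟩ : ∃ y : Fin N → A, x = fun i => I.mkQ (y i) :=
      ⟨fun i => (x i).out, by simp⟩
    rw [quotAct_mkQ, a.act_comp l h]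
    simp_rw [quotAct_mkQ]

end NSOperad.Alg

/-- A family of subspaces which is a suboperad. -/
structure NSOperad.IsSuboperad (P : NSOperad K) (S : ∀ n, Submodule K (P.Op n)) : Prop where
  one_mem : P.one ∈ S 1
  comp_mem : ∀ {n N : ℕ} (l : Fin n → ℕ) (h : ∑ j, l j = N) (μ : P.Op n) (ν : ∀ j, P.Op (l j)),
    μ ∈ S n → (∀ j, ν j ∈ S (l j)) → P.comp l h μ ν ∈ S N

/-- A suboperad, as an operad. -/
def NSOperad.sub (P : NSOperad K) (S : ∀ n, Submodule K (P.Op n)) (hS : P.IsSuboperad S) :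
    NSOperad K where
  Op n := S n
  one := ⟨P.one, hS.one_mem⟩
  comp {n N} l h :=
    { toFun := fun μ => MultilinearMap.codRestrict
        ((P.comp l h μ.1).compLinearMap fun j => (S (l j)).subtype) (S N)
        fun ν => hS.comp_mem l h _ _ μ.2 fun j => (ν j).2
      map_add' := fun μ ν => by ext x; simp; rfl
      map_smul' := fun c μ => by ext x; simp; rfl }
  one_comp h ν := Subtype.ext (P.one_comp h ν.1)
  comp_one h μ := Subtype.ext (P.comp_one h μ.1)
  comp_assoc l h r hr h' μ ν ξ :=
    Subtype.ext (P.comp_assoc l h r hr h' μ.1 (fun j => (ν j).1) fun k => (ξ k).1)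
  subsingleton_zero := ⟨fun a b => Subtype.ext (P.subsingleton_zero.elim a.1 b.1)⟩
  one_ne_zero h := P.one_ne_zero (congrArg Subtype.val h)
  eq_smul_one μ := (P.eq_smul_one μ.1).imp fun _ h => Subtype.ext h

section UEA
variable {P : NSOperad K} {S : ∀ n, Submodule K (P.Op n)} {hS : P.IsSuboperad S}
  {L : Type u} [AddCommGroup L] [Module K L]

/-- For an algebra `L` over a suboperad `S` of `P`: the ideal of the free algebra `P(L)` generated by
the elements `μ ⊗ (x₁ ⊗ ⋯ ⊗ xₙ) - μ(x₁, …, xₙ)`, for `μ ∈ S(n)`, the second term being computed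
in `L`. -/
def ueaIdeal (a : (P.sub S hS).Alg L) : Submodule K (P.Free L) :=
  (NSOperad.Free.alg P L).idealSpan
    {z | ∃ (n : ℕ) (μ : S n) (x : Fin n → L),
      z = NSOperad.Free.word μ.1 x - NSOperad.Free.ι P L (a.act n μ x)}

/-- The universal enveloping algebra `U(L)`: the value at `L` of the left adjoint of the restriction
functor from `P`-algebras to `S`-algebras; see `UEA.existsUnique_lift` for the universal property. -/
abbrev UEA (a : (P.sub S hS).Alg L) : Type u := P.Free L ⧸ ueaIdeal a

/-- The quotient map `P(L) → U(L)`. -/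
def UEA.mk (a : (P.sub S hS).Alg L) : P.Free L →ₗ[K] UEA a := (ueaIdeal a).mkQ

/-- The `P`-algebra structure of `U(L)`. -/
def UEA.alg (a : (P.sub S hS).Alg L) : P.Alg (UEA a) :=
  (NSOperad.Free.alg P L).quot (ueaIdeal a) (NSOperad.Alg.isIdeal_idealSpan _ _)

theorem UEA.existsUnique_lift (a : (P.sub S hS).Alg L) {B : Type u} [AddCommGroup B] [Module K B]
    (b : P.Alg B) (f : L →ₗ[K] B)
    (hf : ∀ (n : ℕ) (μ : S n) (x : Fin n → L), f (a.act n μ x) = b.act n μ.1 fun i => f (x i)) :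
    ∃! g : UEA a →ₗ[K] B, (UEA.alg a).IsHom b g ∧
      ∀ x, g (UEA.mk a (NSOperad.Free.ι P L x)) = f x := by
  obtain ⟨F, ⟨hF, hFι⟩, huniq⟩ := NSOperad.Free.existsUnique_lift b f
  have hker : ueaIdeal a ≤ LinearMap.ker F := by
    refine sInf_le ⟨?_, ?_⟩
    · intro n μ x i hx
      rw [LinearMap.mem_ker] at hx ⊢
      rw [hF]
      exact MultilinearMap.map_coord_zero _ i hx
    · rintro z ⟨n, μ, x, rfl⟩
      rw [SetLike.mem_coe, LinearMap.mem_ker, map_sub, hFι, hf, NSOperad.Free.word_eq]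
      refine sub_eq_zero.2 ((hF n μ.1 _).trans ?_)
      simp_rw [hFι]
  have hmk : ∀ z, (ueaIdeal a).liftQ F hker (UEA.mk a z) = F z := fun z =>
    Submodule.liftQ_apply _ _ _
  refine ⟨(ueaIdeal a).liftQ F hker, ⟨?_, fun x => by rw [hmk, hFι]⟩, ?_⟩
  · intro n μ x
    obtain ⟨x, rfl⟩ : ∃ y : Fin n → P.Free L, x = fun i => UEA.mk a (y i) :=
      ⟨fun i => (x i).out, by funext i; simp [UEA.mk]⟩
    have := NSOperad.Alg.quotAct_mkQ (NSOperad.Free.alg P L) (ueaIdeal a)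
      (NSOperad.Alg.isIdeal_idealSpan _ _) μ x
    simp_rw [hmk]
    rw [← hF, ← hmk]
    exact congrArg _ this
  · rintro g ⟨hg, hgι⟩
    have : g ∘ₗ UEA.mk a = F := by
      refine huniq _ ⟨?_, hgι⟩
      intro n μ x
      have := NSOperad.Alg.quotAct_mkQ (NSOperad.Free.alg P L) (ueaIdeal a)
        (NSOperad.Alg.isIdeal_idealSpan _ _) μ x
      exact (congrArg g this).symm.trans (hg n μ _)
    refine LinearMap.ext fun z => ?_
    obtain ⟨z, rfl⟩ := (ueaIdeal a).mkQ_surjective z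
    exact (LinearMap.congr_fun this z).trans (hmk z).symm

end UEA

namespace NSOperad.Coalg
variable {C : NSOperad K} {H H' : Type u} [AddCommGroup H] [Module K H] [AddCommGroup H']
  [Module K H']

/-- Morphisms of coalgebras over an operad. -/
def IsHom (c : C.Coalg H) (c' : C.Coalg H') (f : H →ₗ[K] H') : Prop :=
  ∀ (n : ℕ) (δ : C.Op n) (x : H),
    c'.coact n δ (f x) = PiTensorProduct.map (fun _ => f) (c.coact n δ x)

/-- `F_r H`: the elements which are annihilated by every cooperation of arity `> r`. -/
def filtration (c : C.Coalg H) (r : ℕ) : Submodule K H :=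
  ⨅ (n : ℕ) (_ : r < n) (δ : C.Op n), LinearMap.ker (c.coact n δ)

/-- The primitive part: the elements annihilated by every nontrivial cooperation. -/
def prim (c : C.Coalg H) : Submodule K H :=
  ⨅ (n : ℕ) (_ : 2 ≤ n) (δ : C.Op n), LinearMap.ker (c.coact n δ)

/-- Connectedness (conilpotency): `H` is the union of the `F_r H`, `r ≥ 1`. -/
def Connected (c : C.Coalg H) : Prop := ∀ x : H, ∃ r : ℕ, 1 ≤ r ∧ x ∈ c.filtration r
end NSOperad.Coalg

/-- A term of the right-hand side of a nonsymmetric distributive compatibility relation for a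
cooperation of arity `m` and an operation of arity `n`: first cooperations `δ i ∈ C(l i)` are
applied to the `n` inputs, giving `r = ∑ l i` factors in all; then, without permuting the factors,
operations `μ j ∈ A(k j)` are applied to consecutive blocks, giving `m` outputs. -/
structure DistTerm (C A : NSOperad K) (m n : ℕ) where
  r : ℕ
  k : Fin m → ℕ
  hk : ∑ j, k j = r
  μ : ∀ j, A.Op (k j)
  l : Fin n → ℕ
  hl : ∑ i, l i = r
  δ : ∀ i, C.Op (l i)

/-- The map `H^n → H^{⊗m}` given by `(μ 0 ⊗ ⋯ ⊗ μ (m-1)) ∘ (δ 0 ⊗ ⋯ ⊗ δ (n-1))`. -/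
def DistTerm.eval {C A : NSOperad K} {m n : ℕ} (t : DistTerm C A m n) {H : Type u}
    [AddCommGroup H] [Module K H] (a : A.Alg H) (c : C.Coalg H) (x : Fin n → H) : ⨂[K]^m H :=
  PiTensorProduct.map (fun j => PiTensorProduct.lift (a.act (t.k j) (t.μ j)))
    (splitEquiv H t.k t.hk ((splitEquiv H t.l t.hl).symm
      (PiTensorProduct.tprod K fun i => c.coact (t.l i) (t.δ i) (x i))))

/-- The data of a nonsymmetric type of generalized `C^c`-`A`-bialgebras: two nonsymmetric operads and
a set of compatibility relations. `rel δ μ Φ` says that `δ ∘ μ = ∑ Φ` is one of the relations. -/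
structure BialgType (K : Type u) [Field K] where
  C : NSOperad K
  A : NSOperad K
  rel : ∀ {m n : ℕ}, C.Op m → A.Op n → List (DistTerm C A m n) → Prop

namespace BialgType
variable (T : BialgType K)

/-- A `C^c`-`A`-bialgebra: an `A`-algebra and `C^c`-coalgebra satisfying the compatibility relations. -/
def IsBialgebra {H : Type u} [AddCommGroup H] [Module K H] (a : T.A.Alg H) (c : T.C.Coalg H) :
    Prop :=
  ∀ {m n : ℕ} (δ : T.C.Op m) (μ : T.A.Op n) (Φ : List (DistTerm T.C T.A m n)), T.rel δ μ Φ →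
    ∀ x : Fin n → H, c.coact m δ (a.act n μ x) = (Φ.map fun t => t.eval a c x).sum

/-- Every pair of a nontrivial cooperation and a nontrivial operation has a distributive
compatibility relation. -/
def H0 : Prop :=
  ∀ {m n : ℕ}, 2 ≤ m → 2 ≤ n → ∀ (δ : T.C.Op m) (μ : T.A.Op n), ∃ Φ, T.rel δ μ Φ

/-- A bialgebra structure on the free `A`-algebra `A(V)`, functorial in `V`. -/
structure H1 where
  coalg : ∀ (V : Type u) [AddCommGroup V] [Module K V], T.C.Coalg (T.A.Free V)
  isBialgebra : ∀ (V : Type u) [AddCommGroup V] [Module K V],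
    T.IsBialgebra (NSOperad.Free.alg T.A V) (coalg V)
  natural : ∀ (V W : Type u) [AddCommGroup V] [Module K V] [AddCommGroup W] [Module K W]
    (f : V →ₗ[K] W), (coalg V).IsHom (coalg W) (NSOperad.Free.map T.A f)

variable {T}

/-- The primitive operations `P(n) ⊆ A(n)`: those `μ` for which `μ(x₁, …, xₙ)` is primitive in
`A(K x₁ ⊕ ⋯ ⊕ K xₙ)`. -/
def primOp (h1 : T.H1) (n : ℕ) : Submodule K (T.A.Op n) where
  carrier := {μ | NSOperad.Free.word μ (fun i : Fin n => (Pi.single i 1 : Fin n → K)) ∈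
    (h1.coalg (Fin n → K)).prim}
  zero_mem' := by
    simp only [Set.mem_ofPred_eq, NSOperad.Free.word, TensorProduct.zero_tmul, map_zero]
    exact zero_mem _
  add_mem' {μ ν} hμ hν := by
    simp only [Set.mem_ofPred_eq, NSOperad.Free.word, TensorProduct.add_tmul, map_add] at *
    exact add_mem hμ hν
  smul_mem' c μ hμ := by
    simp only [Set.mem_ofPred_eq, NSOperad.Free.word, ← TensorProduct.smul_tmul', map_smul] at *
    exact Submodule.smul_mem _ _ hμ

/-- `φ` is the coalgebra map `φ(V) : A(V) → C^c(V)` which covers the projection `A(V) → V`. (There is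
at most one.) -/
def IsPhi (h1 : T.H1) (V : Type u) [AddCommGroup V] [Module K V]
    (φ : T.A.Free V →ₗ[K] T.C.Cofree V) : Prop :=
  (h1.coalg V).IsHom (NSOperad.Cofree.coalg T.C V) φ ∧
    ∀ x, NSOperad.Cofree.proj T.C V (φ x) = NSOperad.Free.proj T.A V x

/-- The map `C^c(V) → A(V)` induced by linear maps `s n : C(n)^* → A(n)`. -/
def splitting (s : ∀ n, Module.Dual K (T.C.Op n) →ₗ[K] T.A.Op n) (V : Type u) [AddCommGroup V]
    [Module K V] : T.C.Cofree V →ₗ[K] T.A.Free V :=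
  DirectSum.lmap fun n => TensorProduct.map (s n) LinearMap.id

/-- `φ(V)` has a splitting by coalgebra maps induced by linear maps `C(n)^* → A(n)`. -/
def H2epi (h1 : T.H1) : Prop :=
  ∃ s : ∀ n, Module.Dual K (T.C.Op n) →ₗ[K] T.A.Op n,
    ∀ (V : Type u) [AddCommGroup V] [Module K V],
      (NSOperad.Cofree.coalg T.C V).IsHom (h1.coalg V) (splitting s V) ∧
      ∃ φ, IsPhi h1 V φ ∧ ∀ y, φ (splitting s V y) = y

/-- `φ(V)` is an isomorphism. -/
def H2iso (h1 : T.H1) : Prop :=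
  ∀ (V : Type u) [AddCommGroup V] [Module K V], ∃ φ, IsPhi h1 V φ ∧ Function.Bijective φ

end BialgType

end NSBialg
end

/-!
Write `A(V)`, `C^c(V)` for the free algebra and the cofree coalgebra, and `V = Prim H`.

The generators of `A(V)` are primitive by functoriality (`BialgType.ι_mem_prim`), and the
compatibility relations compute the cooperations on a word from those on its letters. Hence a
linear map from a vector space to the primitive part of a bialgebra extends to a coalgebra map on
the free algebra (`BialgType.lift_isHom`). Applied to `K^n`, this shows that primitive operations
preserve primitive elements, so that they form a suboperad and `Prim H` is an algebra over it. The
defining ideal of `U(Prim H)` is generated by primitive elements, hence is a coideal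
(`BialgType.map_mk_coact_eq_zero`), which gives the bialgebra structure of `U(Prim H)`.

The main tool is the comparison principle `Cofree.bijective_of_ι`: a coalgebra map from `C^c(Prim
H)` to a connected coalgebra `H` which is the identity on `Prim H` is bijective. It is proved by
induction along the filtration, as the cooperations of arity `r` map `F_r H` into `(Prim H)^{⊗r}`
with common kernel `F_{r-1} H`.

Under `H2iso` it applies to `C^c(V) ≅ A(V) → H`, where the first map is the inverse of `φ(V)`, and
yields the rigidity theorem. Under `H2epi` it applies to the composite of `s(V) : C^c(V) → A(V)`
with `A(V) → H`, and yields `H ≅ C^c(V)` for connected `H`. This composite factors through `U(V) →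
H`, so it remains to see that `C^c(V) → U(V)` is surjective. The comparison principle for the
connected bialgebra `A(V)` writes every element of `A(V)` as a combination of operations `s_n(f)`
applied to elements of `Prim A(V)`. As the compatibility relations involve no permutations, `Prim
A(V)` consists of the primitive operations applied to elements of `V`
(`BialgType.mem_span_of_mem_prim`), and those are identified with elements of `V` in `U(V)`.
-/

noncomputable section
namespace NSBialg

/-! ### Tensor powers over a field -/

theorem blk_ones {r : ℕ} (h : ∑ _j : Fin r, 1 = r) (j : Fin r) (q : Fin 1) :
    blk h ⟨j, q⟩ = j := by
  apply Fin.ext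
  rw [blk_val]
  have : (∑ i : Fin r, if i < j then 1 else 0) = (j : ℕ) := by
    rw [Finset.sum_boole, Nat.cast_id]
    rw [Finset.filter_gt_eq_Iio, Fin.card_Iio]
  simp [this]

section tensors
variable {K : Type u} [Field K]

/-- Evaluation of a tensor on a family of functionals, one for each factor. -/
def pairing {r : ℕ} {M : Fin r → Type u} [∀ i, AddCommGroup (M i)] [∀ i, Module K (M i)]
    (g : ∀ i, Module.Dual K (M i)) : (⨂[K] i, M i) →ₗ[K] K :=
  PiTensorProduct.dualDistrib (PiTensorProduct.tprod K g)

theorem pairing_tprod {r : ℕ} {M : Fin r → Type u} [∀ i, AddCommGroup (M i)]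
    [∀ i, Module K (M i)] (g : ∀ i, Module.Dual K (M i)) (x : ∀ i, M i) :
    pairing g (PiTensorProduct.tprod K x) = ∏ i, g i (x i) :=
  PiTensorProduct.dualDistrib_apply g x

theorem pairing_map {r : ℕ} {M N : Fin r → Type u} [∀ i, AddCommGroup (M i)]
    [∀ i, Module K (M i)] [∀ i, AddCommGroup (N i)] [∀ i, Module K (N i)]
    (g : ∀ i, Module.Dual K (N i)) (f : ∀ i, M i →ₗ[K] N i) (t : ⨂[K] i, M i) :
    pairing g (PiTensorProduct.map f t) = pairing (fun i => g i ∘ₗ f i) t := by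
  have : pairing g ∘ₗ PiTensorProduct.map f = pairing (fun i => g i ∘ₗ f i) := by
    refine PiTensorProduct.ext (MultilinearMap.ext fun x => ?_)
    simp [pairing_tprod]
  exact LinearMap.congr_fun this t

variable {H : Type u} [AddCommGroup H] [Module K H]

theorem pairing_update_add {r : ℕ} (g : Fin r → Module.Dual K H) (i : Fin r)
    (a b : Module.Dual K H) (t : ⨂[K]^r H) :
    pairing (Function.update g i (a + b)) t =
      pairing (Function.update g i a) t + pairing (Function.update g i b) t := by
  simp only [pairing, MultilinearMap.map_update_add, map_add, LinearMap.add_apply]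

theorem eq_of_pairing_eq {r : ℕ} {t t' : ⨂[K]^r H}
    (h : ∀ g : Fin r → Module.Dual K H, pairing g t = pairing g t') : t = t' := by
  classical
  let b := Module.Basis.ofVectorSpace K H
  refine (Basis.piTensorProduct fun _ : Fin r => b).ext_elem fun p => ?_
  have key : ∀ z : ⨂[K]^r H, (Basis.piTensorProduct fun _ : Fin r => b).repr z p =
      pairing (fun i => b.coord (p i)) z := by
    intro z
    induction z using PiTensorProduct.induction_on with
    | add x y hx hy => simp only [map_add, Finsupp.add_apply, hx, hy]
    | smul_tprod c x => simp [pairing_tprod]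
  rw [key, key, h]

/-- Contracting all factors but the `i`-th one leaves a vector. -/
theorem exists_contraction {r : ℕ} (g : Fin r → Module.Dual K H) (i : Fin r) (t : ⨂[K]^r H) :
    ∃ x : H, ∀ f : Module.Dual K H, pairing (Function.update g i f) t = f x := by
  induction t using PiTensorProduct.induction_on with
  | add s t hs ht =>
    obtain ⟨x, hx⟩ := hs
    obtain ⟨y, hy⟩ := ht
    exact ⟨x + y, fun f => by rw [map_add, map_add, hx, hy]⟩
  | smul_tprod c v =>
    refine ⟨(c * ∏ j ∈ Finset.univ.erase i, g j (v j)) • v i, fun f => ?_⟩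
    rw [map_smul, map_smul, pairing_tprod, ← Finset.mul_prod_erase _ _ (Finset.mem_univ i),
      Function.update_self, smul_eq_mul, smul_eq_mul]
    rw [Finset.prod_congr rfl fun j hj => by
      rw [Function.update_of_ne (Finset.ne_of_mem_erase hj)]]
    ring

theorem map_injective {r : ℕ} {X Y : Type u} [AddCommGroup X] [Module K X] [AddCommGroup Y]
    [Module K Y] {f : X →ₗ[K] Y} (hf : Function.Injective f) :
    Function.Injective (PiTensorProduct.map (R := K) fun _ : Fin r => f) := by
  obtain ⟨g, hg⟩ := f.exists_leftInverse_of_injective (LinearMap.ker_eq_bot.2 hf)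
  refine Function.LeftInverse.injective (g := PiTensorProduct.map fun _ : Fin r => g) fun t => ?_
  rw [← LinearMap.comp_apply, ← PiTensorProduct.map_comp, hg, PiTensorProduct.map_id,
    LinearMap.id_apply]

/-- Over a field, `W^{⊗r}` consists of the tensors in `H^{⊗r}` which are annihilated by every family
of functionals one of which vanishes on `W`. If `p` is a projection onto `W`, the functionals `g i`
can be replaced by `g i ∘ p` one after the other. -/
theorem map_projection_eq_self {r : ℕ} {W : Submodule K H} {p : H →ₗ[K] W}
    (hp : p ∘ₗ W.subtype = LinearMap.id) {t : ⨂[K]^r H}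
    (h : ∀ (g : Fin r → Module.Dual K H) (i : Fin r), (∀ w ∈ W, g i w = 0) → pairing g t = 0) :
    PiTensorProduct.map (fun _ => W.subtype) (PiTensorProduct.map (fun _ => p) t) = t := by
  classical
  refine eq_of_pairing_eq fun g => ?_
  rw [pairing_map, pairing_map]
  set P : H →ₗ[K] H := W.subtype ∘ₗ p with hP
  have key : ∀ s : Finset (Fin r),
      pairing (s.piecewise (fun i => g i ∘ₗ P) g) t = pairing g t := by
    intro s
    induction s using Finset.induction_on with
    | empty => simp
    | insert i s hi ih =>
      rw [← ih, Finset.piecewise_insert]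
      set g' := s.piecewise (fun i => g i ∘ₗ P) g
      have hg' : g' = Function.update g' i (g i ∘ₗ P + (g i - g i ∘ₗ P)) := by
        rw [eq_comm, Function.update_eq_self_iff]
        simp [g', hi]
      conv_rhs => rw [hg', pairing_update_add]
      rw [h (Function.update g' i (g i - g i ∘ₗ P)) i, add_zero]
      intro w hw
      have := LinearMap.congr_fun hp ⟨w, hw⟩
      simp only [LinearMap.comp_apply, Submodule.subtype_apply, LinearMap.id_apply] at this
      simp [hP, this]
  simpa [LinearMap.comp_assoc, hP] using key Finset.univ

theorem splitEquiv_symm_map {U W : Type u} [AddCommGroup U] [Module K U] [AddCommGroup W]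
    [Module K W] {n N : ℕ} (l : Fin n → ℕ) (h : ∑ j, l j = N) (f : U →ₗ[K] W)
    (t : ⨂[K] j, ⨂[K]^(l j) U) :
    (splitEquiv W l h).symm (PiTensorProduct.map (fun _ => PiTensorProduct.map fun _ => f) t) =
      PiTensorProduct.map (fun _ => f) ((splitEquiv U l h).symm t) := by
  rw [LinearEquiv.symm_apply_eq]
  change _ = split W l h _
  rw [NSOperad.Cofree.split_map]
  congr 1
  exact ((splitEquiv U l h).apply_symm_apply t).symm

end tensors

variable {K : Type u} [Field K]

namespace NSOperad

theorem op_zero_eq (P : NSOperad K) (μ : P.Op 0) : μ = 0 := P.subsingleton_zero.elim _ _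

/-! ### Coalgebras and their filtration -/

namespace Coalg
variable {C : NSOperad K} {H H' : Type u} [AddCommGroup H] [Module K H] [AddCommGroup H']
  [Module K H'] {c : C.Coalg H} {c' : C.Coalg H'}

theorem mem_filtration {r : ℕ} {x : H} :
    x ∈ c.filtration r ↔ ∀ n, r < n → ∀ δ : C.Op n, c.coact n δ x = 0 := by
  simp [filtration, Submodule.mem_iInf]

theorem mem_prim {x : H} :
    x ∈ c.prim ↔ ∀ n, 2 ≤ n → ∀ δ : C.Op n, c.coact n δ x = 0 := by
  simp [prim, Submodule.mem_iInf]

theorem filtration_mono {r s : ℕ} (h : r ≤ s) : c.filtration r ≤ c.filtration s :=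
  fun _ hx => mem_filtration.2 fun n hn => mem_filtration.1 hx n (h.trans_lt hn)

theorem eq_zero_of_tprod_eq_zero {x : H} (h : PiTensorProduct.tprod K (fun _ : Fin 1 => x) = 0) :
    x = 0 := by
  have := congrArg (PiTensorProduct.subsingletonEquiv (R := K) (s := fun _ : Fin 1 => H) 0) h
  rwa [PiTensorProduct.subsingletonEquiv_apply_tprod, map_zero] at this

theorem eq_zero_of_mem_filtration_zero {x : H} (hx : x ∈ c.filtration 0) : x = 0 := by
  have := mem_filtration.1 hx 1 one_pos C.one
  rw [c.coact_one] at this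
  exact eq_zero_of_tprod_eq_zero this

/-- Cooperations of arity at most `1` commute with every linear map, at every element. -/
theorem coact_map_of_lt_two (f : H →ₗ[K] H') {n : ℕ} (hn : n < 2) (δ : C.Op n) (x : H) :
    c'.coact n δ (f x) = PiTensorProduct.map (fun _ => f) (c.coact n δ x) := by
  obtain rfl | rfl : n = 0 ∨ n = 1 := by omega
  · rw [op_zero_eq C δ]; simp
  · obtain ⟨a, rfl⟩ := C.eq_smul_one δ
    simp [coact_one]

theorem isHom_of_two_le {f : H →ₗ[K] H'}
    (h : ∀ n, 2 ≤ n → ∀ (δ : C.Op n) x,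
      c'.coact n δ (f x) = PiTensorProduct.map (fun _ => f) (c.coact n δ x)) :
    c.IsHom c' f := fun n δ x => by
  rcases lt_or_ge n 2 with hn | hn
  · exact coact_map_of_lt_two f hn δ x
  · exact h n hn δ x

theorem coact_map_of_mem_prim (f : H →ₗ[K] H') {x : H} (hx : x ∈ c.prim) (hfx : f x ∈ c'.prim)
    (n : ℕ) (δ : C.Op n) :
    c'.coact n δ (f x) = PiTensorProduct.map (fun _ => f) (c.coact n δ x) := by
  rcases lt_or_ge n 2 with hn | hn
  · exact coact_map_of_lt_two f hn δ x
  · rw [mem_prim.1 hx n hn, mem_prim.1 hfx n hn, map_zero]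

theorem IsHom.comp {H'' : Type u} [AddCommGroup H''] [Module K H''] {c'' : C.Coalg H''}
    {g : H' →ₗ[K] H''} {f : H →ₗ[K] H'} (hg : c'.IsHom c'' g) (hf : c.IsHom c' f) :
    c.IsHom c'' (g ∘ₗ f) := fun n δ x => by
  rw [LinearMap.comp_apply, hg, hf, PiTensorProduct.map_comp, LinearMap.comp_apply]

theorem IsHom.symm {e : H ≃ₗ[K] H'} (he : c.IsHom c' e.toLinearMap) :
    c'.IsHom c e.symm.toLinearMap := fun n δ x => by
  obtain ⟨x, rfl⟩ := e.surjective x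
  have h := he n δ x
  rw [LinearEquiv.coe_coe] at h
  rw [h, ← LinearMap.comp_apply (PiTensorProduct.map _) (PiTensorProduct.map _),
    ← PiTensorProduct.map_comp]
  simp

/-- If `g ∘ f` and the surjection `f` are coalgebra maps, then so is `g`. -/
theorem IsHom.of_comp_surjective {H'' : Type u} [AddCommGroup H''] [Module K H'']
    {c'' : C.Coalg H''} {g : H' →ₗ[K] H''} {f : H →ₗ[K] H'} (hgf : c.IsHom c'' (g ∘ₗ f))
    (hf : c.IsHom c' f) (hs : Function.Surjective f) : c'.IsHom c'' g := fun n δ x => by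
  obtain ⟨x, rfl⟩ := hs x
  rw [hf, ← LinearMap.comp_apply g f, hgf, PiTensorProduct.map_comp, LinearMap.comp_apply]

theorem IsHom.mem_prim {f : H →ₗ[K] H'} (hf : c.IsHom c' f) {x : H} (hx : x ∈ c.prim) :
    f x ∈ c'.prim := Coalg.mem_prim.2 fun n hn δ => by
  rw [hf, Coalg.mem_prim.1 hx n hn, map_zero]

theorem IsHom.mem_filtration {f : H →ₗ[K] H'} (hf : c.IsHom c' f) {r : ℕ} {x : H}
    (hx : x ∈ c.filtration r) : f x ∈ c'.filtration r := Coalg.mem_filtration.2 fun n hn δ => by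
  rw [hf, Coalg.mem_filtration.1 hx n hn, map_zero]

theorem Connected.of_surjective {f : H →ₗ[K] H'} (hf : c.IsHom c' f)
    (hs : Function.Surjective f) (hc : c.Connected) : c'.Connected := fun x => by
  obtain ⟨x, rfl⟩ := hs x
  obtain ⟨r, hr, hx⟩ := hc x
  exact ⟨r, hr, hf.mem_filtration hx⟩

/-- On `F_r H`, a family of functionals one of which vanishes on the primitive part annihilates the
cooperations of arity `r`. The vector obtained by contracting the other factors is primitive, since
applying `ε` of arity `n ≥ 2` to the remaining factor amounts to a cooperation of arity
`r - 1 + n > r`. -/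
theorem pairing_coact_eq_zero {r : ℕ} {x : H} (hx : x ∈ c.filtration r) (δ : C.Op r)
    (g : Fin r → Module.Dual K H) (i : Fin r) (hg : ∀ w ∈ c.prim, g i w = 0) :
    pairing g (c.coact r δ x) = 0 := by
  obtain ⟨y, hy⟩ := exists_contraction g i (c.coact r δ x)
  have hyg := hy (g i)
  rw [Function.update_eq_self] at hyg
  rw [hyg]
  refine hg y (mem_prim.2 fun n hn ε => ?_)
  rw [← Module.forall_dual_apply_eq_zero_iff K]
  intro ξ
  rw [← LinearMap.comp_apply, ← hy]
  -- the cooperation `ε` in slot `i` and the identity, as an operation of arity `1`, elsewhere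
  have hE : ∀ j, ∃ (l : ℕ) (E : C.Op l) (G : Module.Dual K (⨂[K]^l H)), 1 ≤ l ∧ (j = i → 2 ≤ l) ∧
      G ∘ₗ c.coact l E = Function.update g i (ξ ∘ₗ c.coact n ε) j := by
    intro j
    by_cases hj : j = i
    · subst hj
      exact ⟨n, ε, ξ, by omega, fun _ => hn, by rw [Function.update_self]⟩
    · refine ⟨1, C.one, g j ∘ₗ (PiTensorProduct.subsingletonEquiv (R := K)
        (s := fun _ : Fin 1 => H) 0).toLinearMap, le_rfl, fun h => absurd h hj, ?_⟩
      rw [Function.update_of_ne hj]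
      refine LinearMap.ext fun z => ?_
      simp [coact_one]
  choose l E G hl hl' hG using hE
  rw [← funext hG, ← pairing_map]
  have hN : r < ∑ j, l j := by
    calc r = ∑ _j : Fin r, 1 := by simp
      _ < ∑ j, l j := Finset.sum_lt_sum (fun j _ => hl j) ⟨i, Finset.mem_univ i, hl' i rfl⟩
  have h0 := c.coact_comp l rfl δ E x
  rw [mem_filtration.1 hx _ hN] at h0
  rw [(LinearEquiv.symm_apply_eq _).1 h0.symm]
  simp

end Coalg

/-! ### Cofree coalgebras -/

namespace Cofree
variable {C : NSOperad K} {V : Type u} [AddCommGroup V] [Module K V]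

variable (C V) in
/-- The inclusion `V = C(1)^* ⊗ V → C^c(V)`. -/
def ι : V →ₗ[K] C.Cofree V :=
  DirectSum.lof K ℕ (fun n => Module.Dual K (C.Op n) ⊗[K] ⨂[K]^n V) 1 ∘ₗ
    TensorProduct.mk K _ _ (Free.unitEquiv C).symm.toLinearMap ∘ₗ
    (PiTensorProduct.subsingletonEquiv (R := K) (s := fun _ : Fin 1 => V) 0).symm.toLinearMap

theorem unitEquiv_symm_one (P : NSOperad K) : (Free.unitEquiv P).symm P.one = 1 := by
  rw [LinearEquiv.symm_apply_eq]
  exact (one_smul K P.one).symm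

theorem ι_apply (v : V) : ι C V v =
    DirectSum.lof K ℕ (fun n => Module.Dual K (C.Op n) ⊗[K] ⨂[K]^n V) 1
      ((Free.unitEquiv C).symm.toLinearMap ⊗ₜ[K] PiTensorProduct.tprod K fun _ => v) := by
  simp only [ι, LinearMap.comp_apply, LinearEquiv.coe_coe, TensorProduct.mk_apply]
  congr 2
  rw [LinearEquiv.symm_apply_eq, PiTensorProduct.subsingletonEquiv_apply_tprod]

theorem ev_one_ι (v : V) : ev C V C.one (ι C V v) = PiTensorProduct.tprod K fun _ => v := by
  rw [ι_apply, ev_lof, LinearEquiv.coe_coe, unitEquiv_symm_one, one_smul]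

theorem ev_ι_of_ne {n : ℕ} (hn : n ≠ 1) (ε : C.Op n) (v : V) : ev C V ε (ι C V v) = 0 := by
  rw [ι_apply, ev_lof_ne hn.symm]

variable (V) in
/-- `ev`, as a linear map in the cooperation. -/
def evHom (n : ℕ) (y : C.Cofree V) : C.Op n →ₗ[K] ⨂[K]^n V where
  toFun ε := ev C V ε y
  map_add' ε ε' := by simp [ev, LinearMap.rTensor_add]
  map_smul' a ε := by simp [ev, LinearMap.rTensor_smul]

theorem ev_smul {n : ℕ} (a : K) (ε : C.Op n) (y : C.Cofree V) :
    ev C V (a • ε) y = a • ev C V ε y := (evHom V n y).map_smul a ε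

theorem ev_zero {n : ℕ} (y : C.Cofree V) : ev C V (0 : C.Op n) y = 0 := (evHom V n y).map_zero

theorem eq_of_ev_eq {y y' : C.Cofree V} (h : ∀ n (ε : C.Op n), ev C V ε y = ev C V ε y') :
    y = y' := by
  have : PiTensorProduct.tprod K (fun _ : Fin 1 => y) = PiTensorProduct.tprod K fun _ => y' := by
    refine ext_ev fun l ε => ?_
    rw [PiTensorProduct.map_tprod, PiTensorProduct.map_tprod]
    congr 1
    exact funext fun j => h _ _
  have := congrArg
    (PiTensorProduct.subsingletonEquiv (R := K) (s := fun _ : Fin 1 => C.Cofree V) 0) this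
  simpa using this

theorem proj_eq (y : C.Cofree V) : proj C V y =
    PiTensorProduct.subsingletonEquiv (R := K) (s := fun _ : Fin 1 => V) 0 (ev C V C.one y) := by
  simp only [proj, ev, LinearMap.comp_apply]
  generalize DirectSum.component K ℕ _ 1 y = t
  induction t using TensorProduct.induction_on with
  | zero => simp
  | add x y hx hy => simp only [map_add, hx, hy]
  | tmul f t => simp

theorem proj_ι (v : V) : proj C V (ι C V v) = v := by
  rw [proj_eq, ev_one_ι, PiTensorProduct.subsingletonEquiv_apply_tprod]

theorem exists_bound (y : C.Cofree V) : ∃ r, ∀ n, r < n → ∀ ε : C.Op n, ev C V ε y = 0 := by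
  induction y using DirectSum.induction_on with
  | zero => exact ⟨0, fun n _ ε => map_zero _⟩
  | add x y hx hy =>
    obtain ⟨r, hr⟩ := hx
    obtain ⟨s, hs⟩ := hy
    refine ⟨max r s, fun n hn ε => ?_⟩
    rw [map_add, hr n ((le_max_left _ _).trans_lt hn), hs n ((le_max_right _ _).trans_lt hn),
      add_zero]
  | of N t =>
    refine ⟨N, fun n hn ε => ?_⟩
    rw [← DirectSum.lof_eq_of K, ev_lof_ne hn.ne]

theorem comp_eq_zero_of_arity_zero {m N : ℕ} {l : Fin m → ℕ} (h : ∑ j, l j = N) (δ : C.Op m)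
    (ε : ∀ j, C.Op (l j)) {j : Fin m} (hj : l j = 0) : C.comp l h δ ε = 0 := by
  refine MultilinearMap.map_coord_zero _ j ?_
  have : Subsingleton (C.Op (l j)) := hj ▸ C.subsingleton_zero
  exact Subsingleton.elim _ _

theorem mem_filtration_of_ev {r : ℕ} {y : C.Cofree V}
    (hy : ∀ n, r < n → ∀ ε : C.Op n, ev C V ε y = 0) : y ∈ (coalg C V).filtration r := by
  refine Coalg.mem_filtration.2 fun n hn δ => ext_ev fun l ε => ?_
  change PiTensorProduct.map _ (coact C V n δ y) = _
  rw [map_ev_coact l rfl, map_zero]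
  by_cases hl : ∃ j, l j = 0
  · obtain ⟨j, hj⟩ := hl
    rw [comp_eq_zero_of_arity_zero rfl δ ε hj, ev_zero, map_zero]
  · push Not at hl
    have : n ≤ ∑ j, l j := by
      calc n = ∑ _j : Fin n, 1 := by simp
        _ ≤ ∑ j, l j := Finset.sum_le_sum fun j _ => Nat.one_le_iff_ne_zero.2 (hl j)
    rw [hy _ (hn.trans_le this), map_zero]

variable (C V) in
theorem connected : (coalg C V).Connected := fun y => by
  obtain ⟨r, hr⟩ := exists_bound y
  exact ⟨max r 1, le_max_right _ _,
    Coalg.filtration_mono (le_max_left _ _) (mem_filtration_of_ev hr)⟩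

theorem split_ones {r : ℕ} (h : ∑ _j : Fin r, 1 = r) (t : ⨂[K]^r V) :
    split V (fun _ : Fin r => 1) h t = PiTensorProduct.map
      (fun _ => (PiTensorProduct.subsingletonEquiv (R := K)
        (s := fun _ : Fin 1 => V) 0).symm.toLinearMap) t := by
  have : split V (fun _ : Fin r => 1) h = PiTensorProduct.map
      (fun _ => (PiTensorProduct.subsingletonEquiv (R := K)
        (s := fun _ : Fin 1 => V) 0).symm.toLinearMap) := by
    refine PiTensorProduct.ext (MultilinearMap.ext fun x => ?_)
    simp only [LinearMap.compMultilinearMap_apply, split_tprod, PiTensorProduct.map_tprod]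
    congr 1
    funext j
    rw [LinearEquiv.coe_coe, LinearEquiv.eq_symm_apply,
      PiTensorProduct.subsingletonEquiv_apply_tprod]
    rw [blk_ones]
  rw [this]

theorem map_ev_one_coact {n : ℕ} (h : ∑ _j : Fin n, 1 = n) (δ : C.Op n) (y : C.Cofree V) :
    PiTensorProduct.map (fun _ => ev C V C.one) (coact C V n δ y) =
      split V (fun _ : Fin n => 1) h (ev C V δ y) := by
  rw [map_ev_coact (fun _ => 1) h, C.comp_one]

/-- The primitive part of `C^c(V)` is `V`. -/
theorem eq_ι_of_mem_prim {y : C.Cofree V} (hy : y ∈ (coalg C V).prim) :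
    y = ι C V (proj C V y) := by
  refine eq_of_ev_eq fun n ε => ?_
  by_cases hn : n = 1
  · subst hn
    obtain ⟨a, rfl⟩ := C.eq_smul_one ε
    rw [ev_smul, ev_smul, ev_one_ι]
    congr 1
    apply (PiTensorProduct.subsingletonEquiv (R := K) (s := fun _ : Fin 1 => V) 0).injective
    rw [← proj_eq, PiTensorProduct.subsingletonEquiv_apply_tprod]
  · rw [ev_ι_of_ne hn]
    obtain rfl | hn : n = 0 ∨ 2 ≤ n := by omega
    · rw [op_zero_eq C ε, ev_zero]
    · have h := map_ev_one_coact (by simp) ε y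
      have h0 : coact C V n ε y = 0 := Coalg.mem_prim.1 hy n hn ε
      rw [h0, map_zero] at h
      exact (split_bijective V _ _).injective (h.symm.trans (map_zero _).symm)

/-- On elements of degree at most `r`, a cooperation of arity `r` cuts the components of degree `r`
into single vectors. -/
theorem coact_eq_map_ι {r : ℕ} {y : C.Cofree V}
    (hy : ∀ n, r < n → ∀ ε : C.Op n, ev C V ε y = 0) (δ : C.Op r) :
    coact C V r δ y = PiTensorProduct.map (fun _ => ι C V) (ev C V δ y) := by
  refine ext_ev fun l ε => ?_
  rw [← LinearMap.comp_apply (PiTensorProduct.map _) (PiTensorProduct.map _),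
    ← PiTensorProduct.map_comp, map_ev_coact l rfl]
  by_cases hl : ∀ j, l j = 1
  · obtain rfl : l = fun _ => 1 := funext hl
    choose a ha using fun j => C.eq_smul_one (ε j)
    obtain rfl : ε = fun j => a j • C.one := funext ha
    have h : ∑ _j : Fin r, 1 = r := by simp
    rw [← map_ev_coact (fun _ => 1) rfl, map_ev_coact (fun _ => 1) h, MultilinearMap.map_smul_univ,
      C.comp_one, ev_smul, map_smul, split_ones]
    have : (fun j => ev C V (a j • C.one) ∘ₗ ι C V) = fun j => a j •
        (PiTensorProduct.subsingletonEquiv (R := K)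
          (s := fun _ : Fin 1 => V) 0).symm.toLinearMap := by
      funext j
      refine LinearMap.ext fun v => ?_
      rw [LinearMap.comp_apply, ev_smul, ev_one_ι]
      rw [LinearMap.smul_apply, LinearEquiv.coe_coe]
      congr 1
      rw [LinearEquiv.eq_symm_apply, PiTensorProduct.subsingletonEquiv_apply_tprod]
    rw [this]
    generalize ev C V δ y = t
    induction t using PiTensorProduct.induction_on with
    | add s t hs ht => simp only [map_add, smul_add, hs, ht]
    | smul_tprod b v =>
      rw [map_smul, map_smul, smul_comm, PiTensorProduct.map_tprod, PiTensorProduct.map_tprod,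
        ← MultilinearMap.map_smul_univ]
      rfl
  · push Not at hl
    obtain ⟨i, hi⟩ := hl
    rw [map_eq_zero _ i (LinearMap.ext fun v => ev_ι_of_ne hi _ v), LinearMap.zero_apply]
    by_cases hl : ∃ j, l j = 0
    · obtain ⟨j, hj⟩ := hl
      rw [comp_eq_zero_of_arity_zero rfl δ ε hj, ev_zero, map_zero]
    · push Not at hl
      have : r < ∑ j, l j := by
        calc r = ∑ _j : Fin r, 1 := by simp
          _ < ∑ j, l j := Finset.sum_lt_sum (fun j _ => Nat.one_le_iff_ne_zero.2 (hl j))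
            ⟨i, Finset.mem_univ i, lt_of_le_of_ne (Nat.one_le_iff_ne_zero.2 (hl i)) (Ne.symm hi)⟩
      rw [hy _ this, map_zero]

/-- Every linear map `C(r) → V^{⊗r}` is represented by an element of `C^c(V)` of degree `r`; this
uses that `C(r)` is finite-dimensional. -/
theorem exists_ev_eq {r : ℕ} (τ : C.Op r →ₗ[K] ⨂[K]^r V) :
    ∃ y : C.Cofree V, (∀ ε : C.Op r, ev C V ε y = τ ε) ∧
      ∀ n, n ≠ r → ∀ ε : C.Op n, ev C V ε y = 0 := by
  let b := Module.finBasis K (C.Op r)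
  refine ⟨DirectSum.lof K ℕ (fun n => Module.Dual K (C.Op n) ⊗[K] ⨂[K]^n V) r
    (∑ i, b.coord i ⊗ₜ[K] τ (b i)), fun ε => ?_, fun n hn ε => ev_lof_ne hn.symm _ _⟩
  rw [map_sum, map_sum]
  simp_rw [ev_lof, Module.Basis.coord_apply, ← map_smul]
  rw [← map_sum, b.sum_repr]

/-- The comparison principle: a coalgebra map from the cofree coalgebra on `Prim H` to a connected
coalgebra `H` which is the identity on `Prim H` is bijective. On both sides, the cooperations of
arity `r` embed `F_r / F_{r-1}` into the linear maps `C(r) → (Prim H)^{⊗r}`, and on the cofree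
side every such map occurs. Injectivity follows by descending from the top degree of an element of
the kernel, and surjectivity by induction on `r`. -/
theorem bijective_of_ι {H : Type u} [AddCommGroup H] [Module K H] {c : C.Coalg H}
    (hc : c.Connected) {θ : C.Cofree c.prim →ₗ[K] H} (hθ : (coalg C c.prim).IsHom c θ)
    (hι : ∀ v, θ (ι C c.prim v) = v) : Function.Bijective θ := by
  have hθι : θ ∘ₗ ι C c.prim = c.prim.subtype := LinearMap.ext hι
  have top : ∀ {r : ℕ} {y : C.Cofree c.prim},
      (∀ n, r < n → ∀ ε : C.Op n, ev C c.prim ε y = 0) → ∀ δ : C.Op r,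
      c.coact r δ (θ y) = PiTensorProduct.map (fun _ => c.prim.subtype) (ev C c.prim δ y) := by
    intro r y hy δ
    rw [hθ]
    change PiTensorProduct.map _ (coact C c.prim r δ y) = _
    rw [coact_eq_map_ι hy, ← LinearMap.comp_apply (PiTensorProduct.map _) (PiTensorProduct.map _),
      ← PiTensorProduct.map_comp, hθι]
  constructor
  · rw [injective_iff_map_eq_zero]
    intro y hy
    have key : ∀ r, (∀ n, r ≤ n → ∀ ε : C.Op n, ev C c.prim ε y = 0) → y = 0 := by
      intro r
      induction r with
      | zero => exact fun h => eq_of_ev_eq fun n ε => by rw [h n n.zero_le, map_zero]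
      | succ r ih =>
        refine fun h => ih fun n hn ε => ?_
        rcases hn.eq_or_lt with rfl | hn
        · apply map_injective (K := K) (c.prim.injective_subtype)
          rw [← top h, hy, map_zero, map_zero]
        · exact h n hn ε
    obtain ⟨r, hr⟩ := exists_bound y
    exact key (r + 1) hr
  · obtain ⟨p, hp⟩ := c.prim.subtype.exists_leftInverse_of_injective c.prim.ker_subtype
    have key : ∀ r, ∀ x ∈ c.filtration r, ∃ y, θ y = x := by
      intro r
      induction r with
      | zero => exact fun x hx => ⟨0, by rw [Coalg.eq_zero_of_mem_filtration_zero hx, map_zero]⟩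
      | succ r ih =>
        intro x hx
        obtain ⟨y, hy, hy'⟩ := exists_ev_eq (PiTensorProduct.map (fun _ => p) ∘ₗ
          (LinearMap.applyₗ x ∘ₗ c.coact (r + 1)))
        have hyr : ∀ n, r + 1 < n → ∀ ε : C.Op n, ev C c.prim ε y = 0 :=
          fun n hn => hy' n hn.ne'
        -- `y` has the cooperations of arity `r + 1` of `x`, so `x - θ y` lies in `F_r`
        obtain ⟨z, hz⟩ := ih (x - θ y) (Coalg.mem_filtration.2 fun n hn δ => by
          rw [map_sub]
          rcases (Nat.succ_le_of_lt hn).eq_or_lt with rfl | hn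
          · rw [top hyr, hy, sub_eq_zero]
            exact (map_projection_eq_self hp (Coalg.pairing_coact_eq_zero hx δ)).symm
          · rw [Coalg.mem_filtration.1 hx n hn,
              Coalg.mem_filtration.1 (hθ.mem_filtration (mem_filtration_of_ev hyr)) n hn, sub_zero])
        exact ⟨z + y, by rw [map_add, hz, sub_add_cancel]⟩
    intro x
    obtain ⟨r, -, hx⟩ := hc x
    exact key r x hx

end Cofree
end NSOperad

/-! ### Free algebras and primitive operations -/

namespace NSOperad
namespace Free
variable {P : NSOperad K} {V W X : Type u} [AddCommGroup V] [Module K V] [AddCommGroup W]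
  [Module K W] [AddCommGroup X] [Module K X]

theorem map_word (f : V →ₗ[K] W) {n : ℕ} (μ : P.Op n) (v : Fin n → V) :
    map P f (word μ v) = word μ fun i => f (v i) := by
  simp [map, word]

theorem map_ι (f : V →ₗ[K] W) (v : V) : map P f (ι P V v) = ι P W (f v) := by
  rw [ι_apply, ι_apply, map_word]

theorem hom_ext {f g : P.Free V →ₗ[K] X}
    (h : ∀ (n : ℕ) (μ : P.Op n) (v : Fin n → V), f (word μ v) = g (word μ v)) : f = g :=
  LinearMap.ext_on_range span_word fun w => h w.1 w.2.1 w.2.2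

theorem map_comp_map (g : W →ₗ[K] X) (f : V →ₗ[K] W) : map P g ∘ₗ map P f = map P (g ∘ₗ f) :=
  hom_ext fun n μ v => by simp [map_word]

theorem map_id : map P (LinearMap.id : V →ₗ[K] V) = LinearMap.id :=
  hom_ext fun n μ v => by simp [map_word]

theorem word_zero (μ : P.Op 0) (v : Fin 0 → V) : word μ v = 0 := by
  rw [op_zero_eq P μ]; simp [word]

theorem word_smul_one (a : K) (v : Fin 1 → V) : word (a • P.one) v = a • ι P V (v 0) := by
  rw [ι_apply, word, word, ← TensorProduct.smul_tmul', map_smul]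
  congr
  exact funext fun i => by rw [Subsingleton.elim i 0]

/-- Since `P(0) = 0`, the zero map induces the zero map. -/
theorem map_zero_eq : map P (0 : V →ₗ[K] W) = 0 := hom_ext fun n μ v => by
  rw [map_word, LinearMap.zero_apply]
  rcases n with _ | n
  · exact word_zero _ _
  · rw [word, MultilinearMap.map_coord_zero _ 0 rfl, TensorProduct.tmul_zero, LinearMap.map_zero]

theorem lift_ι (a : P.Alg W) (f : V →ₗ[K] W) (v : V) : lift a f (ι P V v) = f v := by
  rw [ι_apply, lift_word, a.act_one]

end Free

theorem Alg.IsHom.symm {P : NSOperad K} {A B : Type u} [AddCommGroup A] [Module K A]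
    [AddCommGroup B] [Module K B] {a : P.Alg A} {b : P.Alg B} {e : A ≃ₗ[K] B}
    (he : a.IsHom b e.toLinearMap) : b.IsHom a e.symm.toLinearMap := fun n μ x => by
  simp only [LinearEquiv.coe_coe]
  rw [LinearEquiv.symm_apply_eq]
  refine Eq.trans ?_ (he n μ _).symm
  simp

end NSOperad

open NSOperad

/-- An algebra map `f` can be moved past the operations of a term of a compatibility relation. -/
theorem DistTerm.map_eval {C A : NSOperad K} {m n : ℕ} (t : DistTerm C A m n) {H H' : Type u}
    [AddCommGroup H] [Module K H] [AddCommGroup H'] [Module K H'] {a : A.Alg H} (c : C.Coalg H)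
    {a' : A.Alg H'} {f : H →ₗ[K] H'} (hf : a.IsHom a' f) (x : Fin n → H) :
    PiTensorProduct.map (fun _ => f) (t.eval a c x) =
      PiTensorProduct.map (fun j => PiTensorProduct.lift (a'.act (t.k j) (t.μ j)))
        (splitEquiv H' t.k t.hk ((splitEquiv H' t.l t.hl).symm (PiTensorProduct.tprod K fun i =>
          PiTensorProduct.map (fun _ => f) (c.coact (t.l i) (t.δ i) (x i))))) := by
  have h1 : ∀ z : ⨂[K]^t.r H, splitEquiv H' t.k t.hk (PiTensorProduct.map (fun _ => f) z) =
      PiTensorProduct.map (fun _ => PiTensorProduct.map fun _ => f) (splitEquiv H t.k t.hk z) :=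
    fun z => Cofree.split_map t.k t.hk (fun _ => f) z
  simp only [DistTerm.eval]
  have h2 : PiTensorProduct.tprod K (fun i =>
      PiTensorProduct.map (fun _ => f) (c.coact (t.l i) (t.δ i) (x i))) =
      PiTensorProduct.map (fun _ => PiTensorProduct.map fun _ => f)
        (PiTensorProduct.tprod K fun i => c.coact (t.l i) (t.δ i) (x i)) :=
    (PiTensorProduct.map_tprod _ _).symm
  rw [h2, splitEquiv_symm_map, h1,
    ← LinearMap.comp_apply (PiTensorProduct.map _) (PiTensorProduct.map _),
    ← LinearMap.comp_apply (PiTensorProduct.map _) (PiTensorProduct.map _),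
    ← PiTensorProduct.map_comp, ← PiTensorProduct.map_comp]
  congr 2
  funext j
  refine PiTensorProduct.ext (MultilinearMap.ext fun y => ?_)
  simp only [LinearMap.compMultilinearMap_apply, LinearMap.comp_apply, PiTensorProduct.map_tprod,
    PiTensorProduct.lift.tprod]
  exact hf _ _ _

/-- The terms of the compatibility relations are natural for algebra maps which commute with the
cooperations at the inputs. -/
theorem DistTerm.eval_map {C A : NSOperad K} {m n : ℕ} (t : DistTerm C A m n) {H H' : Type u}
    [AddCommGroup H] [Module K H] [AddCommGroup H'] [Module K H'] {a : A.Alg H} {c : C.Coalg H}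
    {a' : A.Alg H'} {c' : C.Coalg H'} {f : H →ₗ[K] H'} (hf : a.IsHom a' f) (x : Fin n → H)
    (hx : ∀ i l (δ : C.Op l),
      c'.coact l δ (f (x i)) = PiTensorProduct.map (fun _ => f) (c.coact l δ (x i))) :
    t.eval a' c' (fun i => f (x i)) = PiTensorProduct.map (fun _ => f) (t.eval a c x) := by
  rw [t.map_eval c hf]
  simp only [DistTerm.eval]
  simp_rw [hx]

namespace BialgType
variable {T : BialgType K} {V : Type u} [AddCommGroup V] [Module K V]

theorem map_coact_ι (h1 : T.H1) {W X : Type u} [AddCommGroup W] [Module K W] [AddCommGroup X]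
    [Module K X] {m : ℕ} (δ : T.C.Op m) (p : Fin m → W →ₗ[K] X) (f : V →ₗ[K] W) (v : V) :
    PiTensorProduct.map (fun j => Free.map T.A (p j))
        ((h1.coalg W).coact m δ (Free.ι T.A W (f v))) =
      PiTensorProduct.map (fun j => Free.map T.A (p j ∘ₗ f))
        ((h1.coalg V).coact m δ (Free.ι T.A V v)) := by
  rw [← Free.map_ι, h1.natural,
    ← LinearMap.comp_apply (PiTensorProduct.map _) (PiTensorProduct.map _),
    ← PiTensorProduct.map_comp]
  simp_rw [Free.map_comp_map]

/-- The generators of `A(V)` are primitive. As `v ↦ δ(v)` is additive, applying `δ` to `(v, v) =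
(v, 0) + (0, v)` in `V × V`, and then mapping one factor of the result to `A(V)` by the first
projection and the others by the second, gives `δ(v) = 0 + 0`, because `A(0) = 0`. (Rescaling `v`
would not do, as `K` may be finite.) -/
theorem ι_mem_prim (h1 : T.H1) (v : V) : Free.ι T.A V v ∈ (h1.coalg V).prim := by
  refine Coalg.mem_prim.2 fun m hm δ => ?_
  obtain ⟨p, hp⟩ : ∃ p : Fin m → V × V →ₗ[K] V, p = fun j : Fin m =>
    if (j : ℕ) = 0 then LinearMap.fst K V V else LinearMap.snd K V V := ⟨_, rfl⟩
  have hl : p ⟨1, hm⟩ ∘ₗ LinearMap.inl K V V = 0 := by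
    rw [hp]; exact LinearMap.snd_comp_inl K V V
  have hr : p ⟨0, by omega⟩ ∘ₗ LinearMap.inr K V V = 0 := by
    rw [hp]; exact LinearMap.fst_comp_inr K V V
  have hd : ∀ j, p j ∘ₗ (LinearMap.inl K V V + LinearMap.inr K V V) = LinearMap.id := by
    intro j
    refine LinearMap.ext fun w => ?_
    by_cases hj : (j : ℕ) = 0 <;> simp [hp, hj]
  have kl := map_coact_ι h1 δ p (LinearMap.inl K V V) v
  rw [Cofree.map_eq_zero (fun j => Free.map T.A (p j ∘ₗ LinearMap.inl K V V)) ⟨1, hm⟩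
    ((congrArg _ hl).trans Free.map_zero_eq), LinearMap.zero_apply] at kl
  have kr := map_coact_ι h1 δ p (LinearMap.inr K V V) v
  rw [Cofree.map_eq_zero (fun j => Free.map T.A (p j ∘ₗ LinearMap.inr K V V)) ⟨0, by omega⟩
    ((congrArg _ hr).trans Free.map_zero_eq), LinearMap.zero_apply] at kr
  have kd := map_coact_ι h1 δ p (LinearMap.inl K V V + LinearMap.inr K V V) v
  simp_rw [hd, Free.map_id] at kd
  rw [PiTensorProduct.map_id, LinearMap.id_apply] at kd
  rw [LinearMap.add_apply, map_add, map_add, map_add, kl, kr, add_zero] at kd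
  exact kd.symm

section lift
variable {H : Type u} [AddCommGroup H] [Module K H] {a : T.A.Alg H} {c : T.C.Coalg H}

/-- A linear map from `V` to the primitive part of a bialgebra extends to a map of bialgebras on
`A(V)`: the compatibility relations compute the cooperations on a word from those on its letters. -/
theorem lift_isHom (h0 : T.H0) (h1 : T.H1) (hb : T.IsBialgebra a c) {f : V →ₗ[K] H}
    (hf : ∀ v, f v ∈ c.prim) : (h1.coalg V).IsHom c (Free.lift a f) := by
  refine Coalg.isHom_of_two_le fun m hm δ x => ?_
  have hι : ∀ v l (ε : T.C.Op l), c.coact l ε (Free.lift a f (Free.ι T.A V v)) =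
      PiTensorProduct.map (fun _ => Free.lift a f)
        ((h1.coalg V).coact l ε (Free.ι T.A V v)) := fun v l ε =>
    Coalg.coact_map_of_mem_prim _ (ι_mem_prim h1 v) (by rw [Free.lift_ι]; exact hf v) l ε
  have key : c.coact m δ ∘ₗ Free.lift a f =
      PiTensorProduct.map (fun _ => Free.lift a f) ∘ₗ (h1.coalg V).coact m δ := by
    refine Free.hom_ext fun n μ v => ?_
    rw [LinearMap.comp_apply, LinearMap.comp_apply]
    rcases lt_or_ge n 2 with hn | hn
    · obtain rfl | rfl : n = 0 ∨ n = 1 := by omega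
      · simp [Free.word_zero]
      · obtain ⟨b, rfl⟩ := T.A.eq_smul_one μ
        simp only [Free.word_smul_one, map_smul, hι]
    · obtain ⟨Φ, hΦ⟩ := h0 hm hn δ μ
      have e1 := h1.isBialgebra V δ μ Φ hΦ fun i => Free.ι T.A V (v i)
      have e2 := hb δ μ Φ hΦ fun i => Free.lift a f (Free.ι T.A V (v i))
      rw [Free.word_eq]
      have e3 := Free.lift_isHom a f n μ fun i => Free.ι T.A V (v i)
      refine (congrArg _ e3).trans (e2.trans (Eq.trans ?_ (congrArg _ e1).symm))
      rw [map_list_sum, List.map_map]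
      congr 2
      funext t
      exact t.eval_map (Free.lift_isHom a f) _ fun i l ε => hι (v i) l ε
  exact LinearMap.congr_fun key x

/-- Primitive operations preserve primitive elements `x i`: the map `A(K^n) → H` sending the `i`-th
generator to `x i` is a coalgebra map. -/
theorem act_mem_prim (h0 : T.H0) (h1 : T.H1) (hb : T.IsBialgebra a c) {n : ℕ} {μ : T.A.Op n}
    (hμ : μ ∈ primOp h1 n) {x : Fin n → H} (hx : ∀ i, x i ∈ c.prim) : a.act n μ x ∈ c.prim := by
  let f : (Fin n → K) →ₗ[K] H := Fintype.linearCombination K x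
  have hf : ∀ v, f v ∈ c.prim := fun v => by
    simp only [f, Fintype.linearCombination_apply]
    exact Submodule.sum_mem _ fun i _ => Submodule.smul_mem _ _ (hx i)
  have h := (lift_isHom h0 h1 hb hf).mem_prim hμ
  rw [Free.lift_word] at h
  simpa [f] using h

end lift

theorem word_mem_prim (h0 : T.H0) (h1 : T.H1) {n : ℕ} {μ : T.A.Op n} (hμ : μ ∈ primOp h1 n)
    (v : Fin n → V) : Free.word μ v ∈ (h1.coalg V).prim := by
  rw [Free.word_eq]
  exact act_mem_prim h0 h1 (h1.isBialgebra V) hμ fun i => ι_mem_prim h1 (v i)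

theorem mem_primOp {h1 : T.H1} {n : ℕ} {μ : T.A.Op n} : μ ∈ primOp h1 n ↔
    Free.word μ (fun i : Fin n => (Pi.single i 1 : Fin n → K)) ∈ (h1.coalg (Fin n → K)).prim :=
  Iff.rfl

theorem isSuboperad_primOp (h0 : T.H0) (h1 : T.H1) : T.A.IsSuboperad (primOp h1) where
  one_mem := by
    have := ι_mem_prim h1 (Pi.single 0 1 : Fin 1 → K)
    rw [Free.ι_apply] at this
    refine mem_primOp.2 ?_
    convert this using 3 with i
    rw [Subsingleton.elim i 0]
  comp_mem {n N} l h μ ν hμ hν := by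
    rw [mem_primOp, Free.word_eq]
    have := (Free.alg T.A (Fin N → K)).act_comp l h μ ν
      (fun i => Free.ι T.A _ (Pi.single i 1 : Fin N → K))
    refine (congrArg (· ∈ (h1.coalg (Fin N → K)).prim) this).mpr ?_
    exact act_mem_prim h0 h1 (h1.isBialgebra _) hμ fun j =>
      act_mem_prim h0 h1 (h1.isBialgebra _) (hν j) fun q => ι_mem_prim h1 _

/-- The primitive part of a bialgebra, as an algebra over the primitive operations. -/
def primAlg (h0 : T.H0) (h1 : T.H1) (hP : T.A.IsSuboperad (primOp h1)) {H : Type u}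
    [AddCommGroup H] [Module K H] {a : T.A.Alg H} {c : T.C.Coalg H} (hb : T.IsBialgebra a c) :
    (T.A.sub (primOp h1) hP).Alg c.prim where
  act n :=
    { toFun := fun μ => MultilinearMap.codRestrict
        ((a.act n μ.1).compLinearMap fun _ => c.prim.subtype) c.prim
        fun x => act_mem_prim h0 h1 hb μ.2 fun i => (x i).2
      map_add' := fun μ ν => by
        refine MultilinearMap.ext fun x => Subtype.ext ?_
        change a.act n (μ.1 + ν.1) _ = a.act n μ.1 _ + a.act n ν.1 _
        rw [map_add]; rfl
      map_smul' := fun r μ => by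
        refine MultilinearMap.ext fun x => Subtype.ext ?_
        change a.act n (r • μ.1) _ = r • a.act n μ.1 _
        rw [map_smul]; rfl }
  act_one x := Subtype.ext (a.act_one fun i => (x i : H))
  act_comp l h μ ν x := Subtype.ext (a.act_comp l h μ.1 (fun j => (ν j).1) fun i => (x i : H))

section UEA
variable {h1 : T.H1} {hP : T.A.IsSuboperad (primOp h1)}
  (L : (T.A.sub (primOp h1) hP).Alg V)

theorem mk_surjective : Function.Surjective (UEA.mk L) := Submodule.mkQ_surjective _

theorem mk_isHom : (Free.alg T.A V).IsHom (UEA.alg L) (UEA.mk L) := fun _ μ x =>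
  (Alg.quotAct_mkQ _ _ (Alg.isIdeal_idealSpan _ _) μ x).symm

theorem mk_word {n : ℕ} (μ : primOp h1 n) (x : Fin n → V) :
    UEA.mk L (Free.word μ.1 x) = UEA.mk L (Free.ι T.A V (L.act n μ x)) := by
  rw [← sub_eq_zero, ← map_sub]
  refine (Submodule.Quotient.mk_eq_zero _).2 ?_
  refine Submodule.mem_sInf.2 fun I hI => hI.2 ⟨n, μ, x, rfl⟩

/-- The ideal defining `U(L)` is a coideal. The elements `z` of the ideal with `δ(z) ↦ 0` for all
cooperations `δ` form an ideal by the compatibility relations, and this ideal contains the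
generators, which are primitive. -/
theorem map_mk_coact_eq_zero (h0 : T.H0) {z : T.A.Free V} (hz : UEA.mk L z = 0) (m : ℕ)
    (δ : T.C.Op m) :
    PiTensorProduct.map (fun _ => UEA.mk L) ((h1.coalg V).coact m δ z) = 0 := by
  let I : Submodule K (T.A.Free V) := LinearMap.ker (UEA.mk L) ⊓
    ⨅ (m : ℕ) (δ : T.C.Op m),
      LinearMap.ker (PiTensorProduct.map (fun _ => UEA.mk L) ∘ₗ (h1.coalg V).coact m δ)
  have hI : ∀ z, z ∈ I ↔ UEA.mk L z = 0 ∧ ∀ m (δ : T.C.Op m),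
      PiTensorProduct.map (fun _ => UEA.mk L) ((h1.coalg V).coact m δ z) = 0 := fun z => by
    simp [I, Submodule.mem_iInf]
  -- cooperations of arity at most `1` impose no condition
  have hI2 : ∀ z, UEA.mk L z = 0 → (∀ m, 2 ≤ m → ∀ δ : T.C.Op m,
      PiTensorProduct.map (fun _ => UEA.mk L) ((h1.coalg V).coact m δ z) = 0) → z ∈ I := by
    refine fun z hz h => (hI z).2 ⟨hz, fun m δ => ?_⟩
    rcases lt_or_ge m 2 with hm | hm
    · obtain rfl | rfl : m = 0 ∨ m = 1 := by omega
      · rw [op_zero_eq T.C δ]; simp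
      · obtain ⟨b, rfl⟩ := T.C.eq_smul_one δ
        rw [map_smul, LinearMap.smul_apply, Coalg.coact_one, map_smul, PiTensorProduct.map_tprod,
          MultilinearMap.map_coord_zero _ 0 hz, smul_zero]
    · exact h m hm δ
  have hideal : (Free.alg T.A V).IsIdeal I := by
    intro n μ x i hx
    obtain ⟨hxi, hxi'⟩ := (hI _).1 hx
    refine hI2 _ ?_ fun m hm δ => ?_
    · rw [mk_isHom]
      exact MultilinearMap.map_coord_zero _ i hxi
    · rcases lt_or_ge n 2 with hn | hn
      · obtain rfl | rfl : n = 0 ∨ n = 1 := by omega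
        · exact i.elim0
        · obtain ⟨b, rfl⟩ := T.A.eq_smul_one μ
          obtain rfl := Subsingleton.elim i 0
          have : (Free.alg T.A V).act 1 (b • T.A.one) x = b • x 0 := by
            rw [map_smul, smul_apply, Alg.act_one]
          rw [this, map_smul, map_smul, hxi', smul_zero]
      · obtain ⟨Φ, hΦ⟩ := h0 hm hn δ μ
        rw [h1.isBialgebra V δ μ Φ hΦ, map_list_sum, List.map_map]
        refine List.sum_eq_zero fun y hy => ?_
        obtain ⟨t, -, rfl⟩ := List.mem_map.1 hy
        rw [Function.comp_apply, t.map_eval _ (mk_isHom L),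
          MultilinearMap.map_coord_zero _ i (hxi' _ _), map_zero, map_zero, map_zero]
  have hle : ueaIdeal L ≤ I := by
    refine sInf_le ⟨hideal, ?_⟩
    rintro _ ⟨n, μ, x, rfl⟩
    refine hI2 _ (by rw [map_sub, mk_word, sub_self]) fun m hm δ => ?_
    rw [map_sub, Coalg.mem_prim.1 (word_mem_prim h0 h1 μ.2 x) m hm,
      Coalg.mem_prim.1 (ι_mem_prim h1 _) m hm, sub_zero, map_zero]
  exact ((hI z).1 (hle ((Submodule.Quotient.mk_eq_zero _).1 hz))).2 m δ

/-- The cooperations on `U(L)`, induced by those on the free algebra. -/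
def ueaCoact (h0 : T.H0) (m : ℕ) (δ : T.C.Op m) : UEA L →ₗ[K] ⨂[K]^m (UEA L) :=
  letI : AddCommGroup (⨂[K]^m (UEA L)) := Module.addCommMonoidToAddCommGroup K
  (ueaIdeal L).liftQ
    (PiTensorProduct.map (fun _ => UEA.mk L) ∘ₗ (h1.coalg V).coact m δ)
    fun z hz => LinearMap.mem_ker.2
      (map_mk_coact_eq_zero L h0 (z := z) ((Submodule.Quotient.mk_eq_zero _).2 hz) m δ)

theorem ueaCoact_mk (h0 : T.H0) (m : ℕ) (δ : T.C.Op m) (z : T.A.Free V) :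
    ueaCoact L h0 m δ (UEA.mk L z) =
      PiTensorProduct.map (fun _ => UEA.mk L) ((h1.coalg V).coact m δ z) := rfl

/-- The coalgebra structure of `U(L)`, as a quotient of the free algebra. -/
def ueaCoalg (h0 : T.H0) : T.C.Coalg (UEA L) where
  coact m :=
    { toFun := ueaCoact L h0 m
      map_add' := fun δ ε => LinearMap.ext fun x => by
        obtain ⟨x, rfl⟩ := mk_surjective L x
        simp only [LinearMap.add_apply, ueaCoact_mk, map_add]
      map_smul' := fun b δ => LinearMap.ext fun x => by
        obtain ⟨x, rfl⟩ := mk_surjective L x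
        simp only [LinearMap.smul_apply, ueaCoact_mk, map_smul, RingHom.id_apply] }
  coact_one x := by
    obtain ⟨x, rfl⟩ := mk_surjective L x
    simp [Coalg.coact_one, ueaCoact_mk]
  coact_comp {n N} l h δ ε x := by
    obtain ⟨x, rfl⟩ := mk_surjective L x
    simp only [LinearMap.coe_mk, AddHom.coe_mk, ueaCoact_mk]
    rw [Coalg.coact_comp _ l h, ← splitEquiv_symm_map]
    rw [← LinearMap.comp_apply (PiTensorProduct.map _) (PiTensorProduct.map _),
      ← LinearMap.comp_apply (PiTensorProduct.map _) (PiTensorProduct.map _),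
      ← PiTensorProduct.map_comp, ← PiTensorProduct.map_comp]
    rfl

theorem mk_isCoalgHom (h0 : T.H0) : (h1.coalg V).IsHom (ueaCoalg L h0) (UEA.mk L) :=
  fun m δ z => ueaCoact_mk L h0 m δ z

theorem uea_isBialgebra (h0 : T.H0) : T.IsBialgebra (UEA.alg L) (ueaCoalg L h0) := by
  intro m n δ μ Φ hΦ x
  obtain ⟨y, rfl⟩ : ∃ y : Fin n → T.A.Free V, x = fun i => UEA.mk L (y i) :=
    ⟨fun i => (mk_surjective L (x i)).choose,
      funext fun i => (mk_surjective L (x i)).choose_spec.symm⟩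
  rw [← mk_isHom, mk_isCoalgHom, h1.isBialgebra V δ μ Φ hΦ, map_list_sum, List.map_map]
  congr 2
  funext t
  exact (t.eval_map (mk_isHom L) y fun i l ε => mk_isCoalgHom L h0 l ε (y i)).symm

end UEA
end BialgType

/-! ### The primitive part of a free algebra -/

/-- A term of a compatibility relation, evaluated at primitive elements `x i`, either vanishes
identically or applies one operation to each of the consecutive blocks of `x 0, …, x (n-1)`. -/
theorem DistTerm.eval_of_mem_prim {C A : NSOperad K} {m n : ℕ} (t : DistTerm C A m n) :
    (∀ {H : Type u} [AddCommGroup H] [Module K H] (a : A.Alg H) (c : C.Coalg H) (x : Fin n → H),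
      (∀ i, x i ∈ c.prim) → t.eval a c x = 0) ∨
    ∃ (h : ∑ j, t.k j = n) (b : K),
      ∀ {H : Type u} [AddCommGroup H] [Module K H] (a : A.Alg H) (c : C.Coalg H) (x : Fin n → H),
        t.eval a c x = b • PiTensorProduct.tprod K fun j =>
          a.act (t.k j) (t.μ j) fun q => x (blk h ⟨j, q⟩) := by
  obtain ⟨r, k, hk, μ, l, hl, δ⟩ := t
  by_cases h1 : ∀ i, l i = 1
  · right
    obtain rfl : l = fun _ => 1 := funext h1
    obtain rfl : r = n := by rw [← hl]; simp
    choose b hb using fun i => C.eq_smul_one (δ i)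
    refine ⟨hk, ∏ i, b i, fun {H} _ _ a c x => ?_⟩
    have h2 : ∀ i, c.coact 1 (δ i) (x i) = b i • PiTensorProduct.tprod K fun _ => x i := fun i => by
      rw [hb, map_smul, LinearMap.smul_apply, c.coact_one]
    have h3 : ∀ i, ((blk hl).symm i).1 = i := fun i => by
      obtain ⟨⟨j, q⟩, rfl⟩ := (blk hl).surjective i
      rw [Equiv.symm_apply_apply, blk_ones]
    simp only [DistTerm.eval]
    simp_rw [h2]
    have h4 := splitEquiv_symm_tprod (K := K) (fun _ : Fin r => 1) hl fun i _ => x i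
    simp_rw [h3] at h4
    rw [MultilinearMap.map_smul_univ, map_smul, h4, map_smul, map_smul]
    congr 1
    change PiTensorProduct.map _ (split H k hk (PiTensorProduct.tprod K x)) = _
    rw [split_tprod, PiTensorProduct.map_tprod]
    simp only [PiTensorProduct.lift.tprod]
  · left
    push Not at h1
    obtain ⟨i, hi⟩ := h1
    intro H _ _ a c x hx
    have h2 : c.coact (l i) (δ i) (x i) = 0 := by
      have h3 : ∀ (p : ℕ) (ε : C.Op p), p ≠ 1 → c.coact p ε (x i) = 0 := fun p ε hp => by
        obtain rfl | hp : p = 0 ∨ 2 ≤ p := by omega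
        · rw [op_zero_eq C ε]; simp
        · exact Coalg.mem_prim.1 (hx i) p hp ε
      exact h3 _ _ hi
    simp only [DistTerm.eval]
    rw [MultilinearMap.map_coord_zero _ i h2, map_zero, map_zero, map_zero]

namespace BialgType
variable {T : BialgType K} {V : Type u} [AddCommGroup V] [Module K V]

/-- The isomorphism `⨂ⱼ (A(k j) ⊗ V^{⊗ k j}) ≅ (⨂ⱼ A(k j)) ⊗ V^{⊗N}`, where `N = ∑ k j`. -/
def collect (A : NSOperad K) (V : Type u) [AddCommGroup V] [Module K V] {m N : ℕ} (k : Fin m → ℕ)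
    (h : ∑ j, k j = N) :
    (⨂[K] j, A.Op (k j) ⊗[K] ⨂[K]^(k j) V) ≃ₗ[K] (⨂[K] j, A.Op (k j)) ⊗[K] ⨂[K]^N V :=
  (zipEquiv (fun j => A.Op (k j)) (fun j => ⨂[K]^(k j) V)).symm ≪≫ₗ
    TensorProduct.congr (LinearEquiv.refl K _) (splitEquiv V k h).symm

theorem collect_tprod (A : NSOperad K) {m N : ℕ} (k : Fin m → ℕ) (h : ∑ j, k j = N)
    (μ : ∀ j, A.Op (k j)) (v : Fin N → V) :
    collect A V k h (PiTensorProduct.tprod K fun j =>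
      μ j ⊗ₜ[K] PiTensorProduct.tprod K fun q => v (blk h ⟨j, q⟩)) =
      PiTensorProduct.tprod K μ ⊗ₜ[K] PiTensorProduct.tprod K v := by
  rw [collect, LinearEquiv.trans_apply, zipEquiv_symm_tprod, TensorProduct.congr_tmul,
    LinearEquiv.refl_apply]
  congr 1
  rw [LinearEquiv.symm_apply_eq]
  exact (split_tprod k h v).symm

/-- The component of multidegree `k` of an element of `A(V)^{⊗m}`, with the operations separated
from the letters. -/
def component (A : NSOperad K) (V : Type u) [AddCommGroup V] [Module K V] {m N : ℕ} (k : Fin m → ℕ)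
    (h : ∑ j, k j = N) : (⨂[K]^m (A.Free V)) →ₗ[K] (⨂[K] j, A.Op (k j)) ⊗[K] ⨂[K]^N V :=
  (collect A V k h).toLinearMap ∘ₗ PiTensorProduct.map fun j =>
    DirectSum.component K ℕ (fun n => A.Op n ⊗[K] ⨂[K]^n V) (k j)

theorem component_word (A : NSOperad K) {m N : ℕ} (k : Fin m → ℕ) (h : ∑ j, k j = N)
    (μ : ∀ j, A.Op (k j)) (v : Fin N → V) :
    component A V k h (PiTensorProduct.tprod K fun j =>
      Free.word (μ j) fun q => v (blk h ⟨j, q⟩)) =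
      PiTensorProduct.tprod K μ ⊗ₜ[K] PiTensorProduct.tprod K v := by
  rw [← collect_tprod A k h, component, LinearMap.comp_apply, PiTensorProduct.map_tprod,
    LinearEquiv.coe_coe]
  congr 2
  funext j
  rw [Free.word, DirectSum.component.lof_self]

theorem component_word_of_ne (A : NSOperad K) {m N : ℕ} {k k' : Fin m → ℕ} (h : ∑ j, k j = N)
    (hk : k' ≠ k) (μ : ∀ j, A.Op (k' j)) (v : ∀ j, Fin (k' j) → V) :
    component A V k h (PiTensorProduct.tprod K fun j => Free.word (μ j) (v j)) = 0 := by
  obtain ⟨j, hj⟩ := Function.ne_iff.1 hk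
  rw [component, LinearMap.comp_apply, PiTensorProduct.map_tprod, MultilinearMap.map_coord_zero _ j,
    map_zero]
  exact DirectSum.of_eq_of_ne _ _ _ hj.symm

theorem eq_zero_of_component (A : NSOperad K) {m : ℕ} {z : ⨂[K]^m (A.Free V)}
    (hz : ∀ k : Fin m → ℕ, component A V k rfl z = 0) : z = 0 := by
  refine (PiTensorProduct.ofDirectSumEquiv (R := K) (ι := Fin m) (κ := fun _ => ℕ)
    (M := fun _ n => A.Op n ⊗[K] ⨂[K]^n V)).injective ?_
  rw [map_zero]
  refine DFinsupp.ext fun k => ?_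
  have key : ∀ y : ⨂[K]^m (A.Free V), PiTensorProduct.ofDirectSumEquiv (R := K) (ι := Fin m)
      (κ := fun _ => ℕ) (M := fun _ n => A.Op n ⊗[K] ⨂[K]^n V) y k = PiTensorProduct.map (fun j =>
        DirectSum.component K ℕ (fun n => A.Op n ⊗[K] ⨂[K]^n V) (k j)) y := by
    intro y
    induction y using PiTensorProduct.induction_on with
    | add x y hx hy => rw [map_add, map_add, ← hx, ← hy]; rfl
    | smul_tprod b x =>
      rw [map_smul, map_smul, PiTensorProduct.map_tprod]
      have := PiTensorProduct.ofDirectSumEquiv_tprod_apply (R := K) (ι := Fin m)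
        (κ := fun _ => ℕ) (M := fun _ n => A.Op n ⊗[K] ⨂[K]^n V) x k
      change b • PiTensorProduct.ofDirectSumEquiv (PiTensorProduct.tprod K x) k = _
      rw [this]; rfl
  rw [key]
  exact (collect A V k rfl).injective ((hz k).trans (map_zero _).symm)

/-- The components of `δ(μ ⊗ v₁ ⋯ vₙ)` of total degree `n` have the form `X ⊗ v₁ ⋯ vₙ`, where `X`
does not depend on the letters. This is where it matters that the compatibility relations involve
no permutation of the factors. -/
theorem exists_component_coact (h0 : T.H0) (h1 : T.H1) {m N : ℕ} (hm : 2 ≤ m) (δ : T.C.Op m)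
    (μ : T.A.Op N) (k : Fin m → ℕ) (h : ∑ j, k j = N) : ∃ X : ⨂[K] j, T.A.Op (k j),
      ∀ {V : Type u} [AddCommGroup V] [Module K V] (v : Fin N → V),
        component T.A V k h ((h1.coalg V).coact m δ (Free.word μ v)) =
          X ⊗ₜ[K] PiTensorProduct.tprod K v := by
  rcases lt_or_ge N 2 with hN | hN
  · refine ⟨0, fun {V} _ _ v => ?_⟩
    obtain rfl | rfl : N = 0 ∨ N = 1 := by omega
    · simp [Free.word_zero]
    · obtain ⟨b, rfl⟩ := T.A.eq_smul_one μ
      rw [Free.word_smul_one, map_smul, Coalg.mem_prim.1 (ι_mem_prim h1 _) m hm]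
      simp
  · obtain ⟨Φ, hΦ⟩ := h0 hm hN δ μ
    have key : ∀ t : DistTerm T.C T.A m N, ∃ X : ⨂[K] j, T.A.Op (k j),
        ∀ {V : Type u} [AddCommGroup V] [Module K V] (v : Fin N → V),
          component T.A V k h
            (t.eval (Free.alg T.A V) (h1.coalg V) fun i => Free.ι T.A V (v i)) =
            X ⊗ₜ[K] PiTensorProduct.tprod K v := by
      intro t
      rcases t.eval_of_mem_prim with ht | ⟨hk, b, ht⟩
      · exact ⟨0, fun {V} _ _ v => by
          rw [ht _ _ _ fun i => ι_mem_prim h1 _, map_zero, TensorProduct.zero_tmul]⟩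
      · by_cases hkk : t.k = k
        · obtain ⟨r, k', hk', μ', l, hl, ε⟩ := t
          obtain rfl : k' = k := hkk
          refine ⟨b • PiTensorProduct.tprod K μ', fun {V} _ _ v => ?_⟩
          rw [ht, map_smul, ← TensorProduct.smul_tmul', ← component_word]
          congr 3
          funext j
          exact (Free.word_eq _ _ _).symm
        · refine ⟨0, fun {V} _ _ v => ?_⟩
          rw [ht, map_smul, TensorProduct.zero_tmul]
          have := component_word_of_ne T.A h hkk t.μ fun j q => v (blk hk ⟨j, q⟩)
          simp_rw [Free.word_eq] at this
          exact (congrArg (b • ·) this).trans (smul_zero b)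
    choose X hX using key
    refine ⟨(Φ.map X).sum, fun {V} _ _ v => ?_⟩
    have e := h1.isBialgebra V δ μ Φ hΦ fun i => Free.ι T.A V (v i)
    rw [Free.word_eq]
    refine (congrArg _ e).trans ?_
    clear e hΦ
    induction Φ with
    | nil => simp
    | cons t Φ ih =>
      simp only [List.map_cons, List.sum_cons, map_add, TensorProduct.add_tmul, ih, hX]

/-- The cooperations on `A(V)` preserve the degree. -/
theorem component_coact_of_ne (h0 : T.H0) (h1 : T.H1) {m n N : ℕ} (hm : 2 ≤ m) (δ : T.C.Op m)
    (μ : T.A.Op n) (v : Fin n → V) (k : Fin m → ℕ) (h : ∑ j, k j = N) (hn : n ≠ N) :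
    component T.A V k h ((h1.coalg V).coact m δ (Free.word μ v)) = 0 := by
  rcases lt_or_ge n 2 with hn2 | hn2
  · obtain rfl | rfl : n = 0 ∨ n = 1 := by omega
    · simp [Free.word_zero]
    · obtain ⟨b, rfl⟩ := T.A.eq_smul_one μ
      rw [Free.word_smul_one, map_smul, Coalg.mem_prim.1 (ι_mem_prim h1 _) m hm]
      simp
  · obtain ⟨Φ, hΦ⟩ := h0 hm hn2 δ μ
    have e := h1.isBialgebra V δ μ Φ hΦ fun i => Free.ι T.A V (v i)
    rw [Free.word_eq]
    refine (congrArg _ e).trans ?_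
    rw [map_list_sum, List.map_map]
    refine List.sum_eq_zero fun y hy => ?_
    obtain ⟨t, -, rfl⟩ := List.mem_map.1 hy
    rw [Function.comp_apply]
    rcases t.eval_of_mem_prim with ht | ⟨hk, b, ht⟩
    · rw [ht _ _ _ fun i => ι_mem_prim h1 _, map_zero]
    · rw [ht, map_smul]
      have hkk : t.k ≠ k := fun e => hn (by rw [← hk, ← h, e])
      have := component_word_of_ne T.A h hkk t.μ fun j q => v (blk hk ⟨j, q⟩)
      simp_rw [Free.word_eq] at this
      exact (congrArg (b • ·) this).trans (smul_zero b)

/-- A cooperation of arity `m > n` vanishes on words of length `n`: one of the `m` blocks into which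
the word is cut is empty, and `A(0) = 0`. -/
theorem word_mem_filtration (h0 : T.H0) (h1 : T.H1) {n : ℕ} (μ : T.A.Op n) (v : Fin n → V) :
    Free.word μ v ∈ (h1.coalg V).filtration n := by
  refine Coalg.mem_filtration.2 fun m hm δ => ?_
  rcases lt_or_ge m 2 with hm2 | hm2
  · obtain rfl : n = 0 := by omega
    rw [Free.word_zero, map_zero]
  · refine eq_zero_of_component T.A fun k => ?_
    by_cases hn : n = ∑ j, k j
    · subst hn
      obtain ⟨X, hX⟩ := exists_component_coact h0 h1 hm2 δ μ k rfl
      obtain ⟨j, hj⟩ : ∃ j, k j = 0 := by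
        by_contra! hk
        have : m ≤ ∑ j, k j := by
          calc m = ∑ _j : Fin m, 1 := by simp
            _ ≤ ∑ j, k j := Finset.sum_le_sum fun j _ => Nat.one_le_iff_ne_zero.2 (hk j)
        omega
      have hX0 : X = 0 := by
        have h2 : Subsingleton (T.A.Op (k j)) := hj ▸ T.A.subsingleton_zero
        have h3 := Cofree.map_eq_zero (K := K) (fun j => (LinearMap.id : T.A.Op (k j) →ₗ[K] _)) j
          (LinearMap.ext fun _ => Subsingleton.elim _ _)
        rw [PiTensorProduct.map_id] at h3
        exact LinearMap.congr_fun h3 X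
      rw [hX, hX0, TensorProduct.zero_tmul]
    · exact component_coact_of_ne h0 h1 hm2 δ μ v k rfl hn

theorem free_connected (h0 : T.H0) (h1 : T.H1) : (h1.coalg V).Connected := by
  have key : ∀ x : T.A.Free V, ∃ r, x ∈ (h1.coalg V).filtration r := by
    intro x
    have hx : x ∈ Submodule.span K (Set.range fun w : (Σ n, T.A.Op n × (Fin n → V)) =>
      (Free.word w.2.1 w.2.2 : T.A.Free V)) := by rw [Free.span_word]; trivial
    induction hx using Submodule.span_induction with
    | mem x hx =>
      obtain ⟨w, rfl⟩ := hx
      exact ⟨w.1, word_mem_filtration h0 h1 _ _⟩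
    | zero => exact ⟨0, zero_mem _⟩
    | add x y _ _ hx hy =>
      obtain ⟨r, hr⟩ := hx
      obtain ⟨s, hs⟩ := hy
      exact ⟨max r s, add_mem (Coalg.filtration_mono (le_max_left _ _) hr)
        (Coalg.filtration_mono (le_max_right _ _) hs)⟩
    | smul b x _ hx => exact hx.imp fun r hr => Submodule.smul_mem _ _ hr
  intro x
  obtain ⟨r, hr⟩ := key x
  exact ⟨max r 1, le_max_right _ _, Coalg.filtration_mono (le_max_left _ _) hr⟩

/-- The primitive part of `A(V)` is `P(V)`. Expanding the degree `N` part of a primitive `z` as `∑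
μ_w ⊗ w` over the words `w` in a basis of `V`, the components of `δ(z)` are `∑ X(μ_w) ⊗ w`, so
that every `X(μ_w)` vanishes; but these also determine `δ(μ_w(e₁, …, e_N))`. -/
theorem mem_span_of_mem_prim (h0 : T.H0) (h1 : T.H1) {z : T.A.Free V}
    (hz : z ∈ (h1.coalg V).prim) :
    z ∈ Submodule.span K {y | ∃ (n : ℕ) (μ : primOp h1 n) (v : Fin n → V),
      y = Free.word μ.1 v} := by
  classical
  rw [← DirectSum.sum_support_of z]
  refine Submodule.sum_mem _ fun N _ => ?_
  let e := Module.Basis.ofVectorSpace K V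
  let B := Basis.piTensorProduct (fun _ : Fin N => e)
  obtain ⟨b, hb⟩ := TensorProduct.eq_repr_basis_right B (z N)
  have hB : ∀ w, B w = PiTensorProduct.tprod K fun i => e (w i) := fun w =>
    Basis.piTensorProduct_apply _ _
  rw [← hb, Finsupp.sum, map_sum]
  refine Submodule.sum_mem _ fun w hw => Submodule.subset_span ?_
  refine ⟨N, ⟨b w, mem_primOp.2 ?_⟩, fun i => e (w i), by
    rw [hB, ← DirectSum.lof_eq_of K]; rfl⟩
  refine Coalg.mem_prim.2 fun m hm δ => eq_zero_of_component T.A fun k => ?_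
  by_cases hN : N = ∑ j, k j
  swap
  · exact component_coact_of_ne h0 h1 hm δ _ _ k rfl hN
  choose X hX using fun μ : T.A.Op N => exists_component_coact h0 h1 hm δ μ k hN.symm
  -- the component of `δ(z)` of multidegree `k` only depends on the degree `N` part of `z`
  let F : T.A.Free V →ₗ[K] _ := component T.A V k hN.symm ∘ₗ (h1.coalg V).coact m δ
  have hF : ∀ n, n ≠ N → ∀ t : T.A.Op n ⊗[K] ⨂[K]^n V,
      F (DirectSum.lof K ℕ (fun n => T.A.Op n ⊗[K] ⨂[K]^n V) n t) = 0 := by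
    intro n hn t
    induction t using TensorProduct.induction_on with
    | zero => rw [map_zero, map_zero]
    | add x y hx hy => rw [map_add, map_add, hx, hy, add_zero]
    | tmul μ t =>
      induction t using PiTensorProduct.induction_on with
      | add x y hx hy => rw [TensorProduct.tmul_add, map_add, map_add, hx, hy, add_zero]
      | smul_tprod r v =>
        rw [TensorProduct.tmul_smul, map_smul, map_smul]
        exact (congrArg (r • ·) (component_coact_of_ne h0 h1 hm δ μ v k hN.symm hn)).trans
          (smul_zero r)
  have hFz : F z = ∑ w ∈ b.support, X (b w) ⊗ₜ[K] B w := by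
    conv_lhs => rw [← DirectSum.sum_support_of z]
    rw [map_sum, Finset.sum_eq_single N]
    · rw [← hb, Finsupp.sum, map_sum, map_sum]
      refine Finset.sum_congr rfl fun w _ => ?_
      rw [hB, ← hX, ← DirectSum.lof_eq_of K]; rfl
    · intro n _ hn
      rw [← DirectSum.lof_eq_of K]; exact hF n hn _
    · intro hN
      rw [DFinsupp.notMem_support_iff.1 hN, map_zero, map_zero]
  have hFz0 : F z = 0 := by
    rw [LinearMap.comp_apply, Coalg.mem_prim.1 hz m hm δ, map_zero]
  have hX0 : X (b w) = 0 := by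
    have := congrArg (fun y => TensorProduct.rid K _ ((B.coord w).lTensor _ y))
      (hFz.symm.trans hFz0)
    simpa [Finsupp.single_apply, ite_smul, Finset.sum_ite_eq, hw] using this
  subst hN
  rw [hX, hX0, TensorProduct.zero_tmul]

end BialgType

/-! ### The structure and rigidity theorems -/

namespace BialgType
variable {T : BialgType K} {V W : Type u} [AddCommGroup V] [Module K V] [AddCommGroup W]
  [Module K W]

theorem splitting_ι {h1 : T.H1} {s : ∀ n, Module.Dual K (T.C.Op n) →ₗ[K] T.A.Op n}
    (hs : ∃ φ, IsPhi h1 V φ ∧ ∀ y, φ (splitting s V y) = y) (v : V) :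
    splitting s V (Cofree.ι T.C V v) = Free.ι T.A V v := by
  obtain ⟨b, hb⟩ := T.A.eq_smul_one (s 1 (Free.unitEquiv T.C).symm.toLinearMap)
  have h : splitting s V (Cofree.ι T.C V v) = b • Free.ι T.A V v := by
    rw [← Free.word_smul_one b fun _ => v, ← hb, Cofree.ι_apply, splitting, DirectSum.lmap_lof]
    rfl
  obtain ⟨φ, hφ, hφs⟩ := hs
  have h2 := hφ.2 (splitting s V (Cofree.ι T.C V v))
  rw [hφs, Cofree.proj_ι, h, map_smul, Free.proj_ι] at h2
  rw [h, ← map_smul, ← h2]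

/-- The map induced on the cofree coalgebras by `f : V → W`. -/
def cofreeMap (C : NSOperad K) (f : V →ₗ[K] W) : C.Cofree V →ₗ[K] C.Cofree W :=
  DirectSum.lmap fun _ => TensorProduct.map LinearMap.id (PiTensorProduct.map fun _ => f)

theorem splitting_natural (s : ∀ n, Module.Dual K (T.C.Op n) →ₗ[K] T.A.Op n) (f : V →ₗ[K] W)
    (y : T.C.Cofree V) :
    Free.map T.A f (splitting s V y) = splitting s W (cofreeMap T.C f y) := by
  have : Free.map T.A f ∘ₗ splitting s V = splitting s W ∘ₗ cofreeMap T.C f := by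
    refine DirectSum.linearMap_ext _ fun n => LinearMap.ext fun t => ?_
    simp only [Free.map, splitting, cofreeMap, LinearMap.comp_apply, DirectSum.lmap_lof]
    congr 1
    rw [← LinearMap.comp_apply, ← LinearMap.comp_apply, ← TensorProduct.map_comp,
      ← TensorProduct.map_comp]
    rfl
  exact LinearMap.congr_fun this y

section
variable {H : Type u} [AddCommGroup H] [Module K H] {a : T.A.Alg H} {c : T.C.Coalg H}

/-- For a connected bialgebra, `C^c(Prim H) → A(Prim H) → H` is an isomorphism of coalgebras. -/
theorem bijective_lift_splitting (h0 : T.H0) {h1 : T.H1} (hb : T.IsBialgebra a c)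
    (hc : c.Connected) {s : ∀ n, Module.Dual K (T.C.Op n) →ₗ[K] T.A.Op n}
    (hs : (Cofree.coalg T.C c.prim).IsHom (h1.coalg c.prim) (splitting s c.prim))
    (hφ : ∃ φ, IsPhi h1 c.prim φ ∧ ∀ y, φ (splitting s c.prim y) = y) :
    Function.Bijective (Free.lift a c.prim.subtype ∘ₗ splitting s c.prim) :=
  Cofree.bijective_of_ι hc ((lift_isHom h0 h1 hb fun v => v.2).comp hs) fun v => by
    rw [LinearMap.comp_apply, splitting_ι hφ, Free.lift_ι]; rfl

/-- Every primitive element of `A(Prim H)` becomes equal in `U(Prim H)` to its value in `Prim H`,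
since it is a combination of primitive operations on elements of `Prim H`. -/
theorem mk_eq_of_mem_prim (h0 : T.H0) {h1 : T.H1} {hP : T.A.IsSuboperad (primOp h1)}
    (hb : T.IsBialgebra a c) {z : T.A.Free c.prim} (hz : z ∈ (h1.coalg c.prim).prim) :
    UEA.mk (primAlg h0 h1 hP hb) z = UEA.mk (primAlg h0 h1 hP hb)
      (Free.ι T.A c.prim ⟨Free.lift a c.prim.subtype z,
        (lift_isHom h0 h1 hb fun v => v.2).mem_prim hz⟩) := by
  have hspan := mem_span_of_mem_prim h0 h1 hz
  obtain ⟨p, hp⟩ := c.prim.subtype.exists_leftInverse_of_injective c.prim.ker_subtype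
  have key : UEA.mk (primAlg h0 h1 hP hb) z = (UEA.mk (primAlg h0 h1 hP hb) ∘ₗ
      Free.ι T.A c.prim ∘ₗ p ∘ₗ Free.lift a c.prim.subtype) z := by
    refine LinearMap.eqOn_span ?_ hspan
    rintro _ ⟨n, μ, v, rfl⟩
    rw [mk_word]
    simp only [LinearMap.comp_apply, Free.lift_word]
    congr 2
    exact (LinearMap.congr_fun hp ((primAlg h0 h1 hP hb).act n μ v)).symm
  rw [key]
  exact congrArg (fun w => UEA.mk (primAlg h0 h1 hP hb) (Free.ι T.A c.prim w))
    (LinearMap.congr_fun hp ⟨_, (lift_isHom h0 h1 hb fun v => v.2).mem_prim hz⟩)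

/-- The map `C^c(Prim H) → A(Prim H) → U(Prim H)` is surjective. By the comparison principle for
the bialgebra `A(Prim H)`, every element of `A(Prim H)` is a value of the operations `s_n(f)` on
primitive elements, which can be replaced by elements of `Prim H` in `U(Prim H)`. -/
theorem surjective_mk_splitting (h0 : T.H0) {h1 : T.H1} {hP : T.A.IsSuboperad (primOp h1)}
    (hb : T.IsBialgebra a c) {s : ∀ n, Module.Dual K (T.C.Op n) →ₗ[K] T.A.Op n}
    (hs : ∀ (V : Type u) [AddCommGroup V] [Module K V],
      (Cofree.coalg T.C V).IsHom (h1.coalg V) (splitting s V) ∧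
      ∃ φ, IsPhi h1 V φ ∧ ∀ y, φ (splitting s V y) = y) :
    Function.Surjective (UEA.mk (primAlg h0 h1 hP hb) ∘ₗ splitting s c.prim) := by
  intro x
  obtain ⟨z, rfl⟩ := mk_surjective _ x
  obtain ⟨y, rfl⟩ := (bijective_lift_splitting h0 (h1.isBialgebra c.prim)
    (free_connected h0 h1) (hs _).1 (hs _).2).surjective z
  let g : (h1.coalg c.prim).prim →ₗ[K] c.prim :=
    LinearMap.restrict (Free.lift a c.prim.subtype)
      fun z hz => (lift_isHom h0 h1 hb fun v => v.2).mem_prim hz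
  have key : UEA.mk (primAlg h0 h1 hP hb) ∘ₗ
      Free.lift (Free.alg T.A c.prim) (h1.coalg c.prim).prim.subtype =
      UEA.mk (primAlg h0 h1 hP hb) ∘ₗ
        Free.map (V := (h1.coalg c.prim).prim) (W := c.prim) T.A g := by
    refine Free.hom_ext fun n μ w => ?_
    rw [LinearMap.comp_apply, LinearMap.comp_apply, Free.lift_word, Free.map_word, Free.word_eq]
    refine (mk_isHom _ n μ _).trans (Eq.trans ?_ (mk_isHom _ n μ _).symm)
    congr 1
    exact funext fun i => mk_eq_of_mem_prim h0 hb (w i).2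
  refine ⟨cofreeMap (V := (h1.coalg c.prim).prim) (W := c.prim) T.C g y, ?_⟩
  rw [LinearMap.comp_apply, ← splitting_natural]
  exact (LinearMap.congr_fun key (splitting s _ y)).symm

/-- The canonical map `U(Prim H) → H`. -/
theorem exists_uea_hom (h0 : T.H0) {h1 : T.H1} {hP : T.A.IsSuboperad (primOp h1)}
    (hb : T.IsBialgebra a c) : ∃ ε : UEA (primAlg h0 h1 hP hb) →ₗ[K] H,
      (UEA.alg (primAlg h0 h1 hP hb)).IsHom a ε ∧
      (ueaCoalg (primAlg h0 h1 hP hb) h0).IsHom c ε ∧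
      ε ∘ₗ UEA.mk (primAlg h0 h1 hP hb) = Free.lift a c.prim.subtype := by
  obtain ⟨ε, ⟨hε, hει⟩, -⟩ := UEA.existsUnique_lift (primAlg h0 h1 hP hb) a c.prim.subtype
    fun n μ x => rfl
  have h : ε ∘ₗ UEA.mk (primAlg h0 h1 hP hb) = Free.lift a c.prim.subtype := by
    refine Free.hom_ext fun n μ v => ?_
    rw [LinearMap.comp_apply, Free.lift_word, Free.word_eq]
    refine (congrArg ε (mk_isHom _ n μ _)).trans ((hε n μ _).trans ?_)
    simp_rw [hει]
  exact ⟨ε, hε, Coalg.IsHom.of_comp_surjective (f := UEA.mk (primAlg h0 h1 hP hb))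
    (h ▸ lift_isHom h0 h1 hb fun v => v.2) (mk_isCoalgHom _ h0) (mk_surjective _), h⟩

end

/-- The equivalence of connectedness with the two isomorphisms. For connected `H`, the bijection
`C^c(Prim H) → U(Prim H) → H` and the surjectivity of its first factor make both factors
bijective. -/
theorem tfae_connected (h0 : T.H0) {h1 : T.H1} (h2 : H2epi h1)
    {hP : T.A.IsSuboperad (primOp h1)} {H : Type u} [AddCommGroup H] [Module K H]
    {a : T.A.Alg H} {c : T.C.Coalg H} (hb : T.IsBialgebra a c) :
    List.TFAE [
      c.Connected,
      ∃ e : H ≃ₗ[K] UEA (primAlg h0 h1 hP hb),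
        a.IsHom (UEA.alg (primAlg h0 h1 hP hb)) e.toLinearMap ∧
        c.IsHom (ueaCoalg (primAlg h0 h1 hP hb) h0) e.toLinearMap,
      ∃ e : H ≃ₗ[K] T.C.Cofree c.prim,
        c.IsHom (Cofree.coalg T.C c.prim) e.toLinearMap] := by
  obtain ⟨s, hs⟩ := h2
  tfae_have 1 → 2 := fun hc => by
    obtain ⟨ε, hε, hεc, hεmk⟩ := exists_uea_hom h0 (hP := hP) hb
    have hbij := bijective_lift_splitting h0 hb hc (hs c.prim).1 (hs c.prim).2
    have hcomp : Free.lift a c.prim.subtype ∘ₗ splitting s c.prim =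
        ε ∘ₗ (UEA.mk (primAlg h0 h1 hP hb) ∘ₗ splitting s c.prim) := by
      rw [← hεmk]; rfl
    rw [hcomp, LinearMap.coe_comp] at hbij
    have hε' : Function.Bijective ε :=
      (Function.Bijective.of_comp_iff ε ⟨hbij.injective.of_comp,
        surjective_mk_splitting h0 hb hs⟩).1 hbij
    let e := LinearEquiv.ofBijective ε hε'
    exact ⟨e.symm, Alg.IsHom.symm (e := e) hε, Coalg.IsHom.symm (e := e) hεc⟩
  tfae_have 1 → 3 := fun hc => by
    let e := LinearEquiv.ofBijective _
      (bijective_lift_splitting h0 hb hc (hs c.prim).1 (hs c.prim).2)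
    exact ⟨e.symm, Coalg.IsHom.symm (e := e) ((lift_isHom h0 h1 hb fun v => v.2).comp (hs _).1)⟩
  tfae_have 2 → 1 := fun ⟨e, _, he⟩ =>
    Coalg.Connected.of_surjective he.symm e.symm.surjective
      ((free_connected h0 h1).of_surjective (mk_isCoalgHom _ h0) (mk_surjective _))
  tfae_have 3 → 1 := fun ⟨e, he⟩ =>
    Coalg.Connected.of_surjective he.symm e.symm.surjective (Cofree.connected T.C c.prim)
  tfae_finish

theorem rigidity (h0 : T.H0) {h1 : T.H1} (h2 : H2iso h1) {H : Type u} [AddCommGroup H]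
    [Module K H] {a : T.A.Alg H} {c : T.C.Coalg H} (hb : T.IsBialgebra a c) (hc : c.Connected) :
    (∃ e : T.A.Free c.prim ≃ₗ[K] H, (Free.alg T.A c.prim).IsHom a e.toLinearMap ∧
      (h1.coalg c.prim).IsHom c e.toLinearMap ∧ ∀ x : c.prim, e (Free.ι T.A c.prim x) = x) ∧
    (∃ e : H ≃ₗ[K] T.C.Cofree c.prim, c.IsHom (Cofree.coalg T.C c.prim) e.toLinearMap ∧
      ∀ x : c.prim, Cofree.proj T.C c.prim (e x) = x) := by
  obtain ⟨φ, hφ, hφb⟩ := h2 c.prim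
  let p := LinearEquiv.ofBijective φ hφb
  have hpι : ∀ v, p.symm (Cofree.ι T.C c.prim v) = Free.ι T.A c.prim v := fun v => by
    rw [LinearEquiv.symm_apply_eq]
    refine Eq.trans ?_ (Cofree.eq_ι_of_mem_prim (hφ.1.mem_prim (ι_mem_prim h1 v))).symm
    rw [hφ.2, Free.proj_ι]
  have hp : (Cofree.coalg T.C c.prim).IsHom (h1.coalg c.prim) p.symm.toLinearMap :=
    Coalg.IsHom.symm (e := p) hφ.1
  have hl := lift_isHom h0 h1 hb (f := c.prim.subtype) fun v => v.2
  have hθι : ∀ v, (Free.lift a c.prim.subtype ∘ₗ p.symm.toLinearMap) (Cofree.ι T.C c.prim v) = v :=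
    fun v => by
      rw [LinearMap.comp_apply, LinearEquiv.coe_coe, hpι, Free.lift_ι]; rfl
  have hθ := Cofree.bijective_of_ι hc (hl.comp hp) hθι
  let t := LinearEquiv.ofBijective _ hθ
  have hlb : Function.Bijective (Free.lift a c.prim.subtype) := by
    rw [LinearMap.coe_comp] at hθ
    exact (Function.Bijective.of_comp_iff _ p.symm.bijective).1 hθ
  refine ⟨⟨LinearEquiv.ofBijective _ hlb, Free.lift_isHom _ _, hl, fun x => ?_⟩,
    ⟨t.symm, Coalg.IsHom.symm (e := t) (hl.comp hp), fun x => ?_⟩⟩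
  · exact Free.lift_ι _ _ _
  · have : t.symm (x : H) = Cofree.ι T.C c.prim x := by
      rw [LinearEquiv.symm_apply_eq]; exact (hθι x).symm
    rw [this, Cofree.proj_ι]

end BialgType

end NSBialg
end

theorem theorem3p3 {K : Type u} [Field K] (T : NSBialg.BialgType K) (h0 : T.H0) (h1 : T.H1) :
    ∃ hP : T.A.IsSuboperad (NSBialg.BialgType.primOp h1),
      -- the structure theorem
      (NSBialg.BialgType.H2epi h1 →
        ∀ (H : Type u) [AddCommGroup H] [Module K H] (a : T.A.Alg H) (c : T.C.Coalg H),
          T.IsBialgebra a c →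
          -- the primitive part is an algebra over the operad of primitive operations
          ∃ L : (T.A.sub (NSBialg.BialgType.primOp h1) hP).Alg c.prim,
            (∀ (n : ℕ) (μ : NSBialg.BialgType.primOp h1 n) (x : Fin n → c.prim),
              (L.act n μ x : H) = a.act n (μ : T.A.Op n) (fun i => (x i : H))) ∧
            -- its enveloping algebra is a bialgebra, as a quotient of the free algebra
            ∃ cU : T.C.Coalg (NSBialg.UEA L),
              (h1.coalg c.prim).IsHom cU (NSBialg.UEA.mk L) ∧
              T.IsBialgebra (NSBialg.UEA.alg L) cU ∧
              List.TFAE [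
                c.Connected,
                ∃ e : H ≃ₗ[K] NSBialg.UEA L,
                  a.IsHom (NSBialg.UEA.alg L) e.toLinearMap ∧ c.IsHom cU e.toLinearMap,
                ∃ e : H ≃ₗ[K] T.C.Cofree c.prim,
                  c.IsHom (NSBialg.NSOperad.Cofree.coalg T.C c.prim) e.toLinearMap]) ∧
      -- the rigidity theorem
      (NSBialg.BialgType.H2iso h1 →
        ∀ (H : Type u) [AddCommGroup H] [Module K H] (a : T.A.Alg H) (c : T.C.Coalg H),
          T.IsBialgebra a c → c.Connected →
          (∃ e : T.A.Free c.prim ≃ₗ[K] H,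
            (NSBialg.NSOperad.Free.alg T.A c.prim).IsHom a e.toLinearMap ∧
            (h1.coalg c.prim).IsHom c e.toLinearMap ∧
            ∀ x : c.prim, e (NSBialg.NSOperad.Free.ι T.A c.prim x) = x) ∧
          (∃ e : H ≃ₗ[K] T.C.Cofree c.prim,
            c.IsHom (NSBialg.NSOperad.Cofree.coalg T.C c.prim) e.toLinearMap ∧
            ∀ x : c.prim, NSBialg.NSOperad.Cofree.proj T.C c.prim (e x) = x)) := by
  exact ⟨NSBialg.BialgType.isSuboperad_primOp h0 h1,
    fun h2 _ _ _ _ _ hb => ⟨NSBialg.BialgType.primAlg h0 h1 _ hb, fun _ _ _ => rfl,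
      NSBialg.BialgType.ueaCoalg _ h0, NSBialg.BialgType.mk_isCoalgHom _ h0,
      NSBialg.BialgType.uea_isBialgebra _ h0, NSBialg.BialgType.tfae_connected h0 h2 hb⟩,
    fun h2 _ _ _ _ _ hb hc => NSBialg.BialgType.rigidity h0 h2 hb hc⟩
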